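/- Let $F$ be a tree of order $\ell\ge 4$ with partite sets $A$ and $B$, $|A|\le |B|$; put $q=|A|-1$ and $\delta=\min\{d_F(x):x\in A\}$. For a graph $G$ let $\rho(G)$ be its spectral radius, i.e. the largest eigenvalue of its adjacency matrix, and let $\mathrm{spex}(n,F)$ be the maximum of $\rho(G)$ over all graphs $G$ of order $n$ that are $F$-free (contain no subgraph isomorphic to $F$). For $n\ge q+2$ let $S_{n,q}^{1}$ be the graph obtained from the join $K_q\nabla (n-q)K_1$ by adding one edge inside the independent set $(n-q)K_1$. Suppose $q\ge 1$ and $\delta\ge 2$. Then $S_{n,q}^{1}$ is $F$-free for every $n\ge q+2$. Moreover, for all sufficiently large $n$ (depending on $F$), $$\frac{q-1}{2}+\sqrt{qn-\frac{3q^2+2q+1}{4}}<\mathrm{spex}(n,F)\le \rho(J),\qquad J=\begin{bmatrix} q-1 & n-q\\ q & \delta-1\end{bmatrix},$$ where $\rho(J)$ is the largest eigenvalue of $J$, and, as $n\to\infty$ with $F$ fixed, $$\rho(J)=\sqrt{qn}+\frac{q+\delta-2}{2}+O\Big(\frac{1}{\sqrt n}\Big).$$ -/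

import Mathlib

/-- The largest real eigenvalue of a real square matrix. For an adjacency matrix, and for any
`2 × 2` matrix with nonnegative entries, this is the spectral radius. -/
noncomputable def matrixRho {m : Type*} [Fintype m] [DecidableEq m] (M : Matrix m m ℝ) : ℝ :=
  sSup (spectrum ℝ M)

open Classical in
/-- The spectral radius of a finite graph: the largest eigenvalue of its adjacency matrix. -/
noncomputable def graphRho {V : Type*} [Fintype V] (G : SimpleGraph V) : ℝ :=
  matrixRho (G.adjMatrix ℝ)

/-- `spex n F` is the maximum spectral radius over all `F`-free graphs of order `n`. -/
noncomputable def spex {V : Type*} (n : ℕ) (F : SimpleGraph V) : ℝ :=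
  sSup {r : ℝ | ∃ G : SimpleGraph (Fin n), F.Free G ∧ graphRho G = r}

/-- The graph `S_{n,k}^p`, meant for `0 < k < n` and `2 * p ≤ n - k`: the join of the complete
graph on the vertices `0, …, k - 1` and the edgeless graph on `k, …, n - 1`, together with the
`p` independent edges `{k + 2t, k + 2t + 1}`, `t < p`. -/
def splitGraph (n k p : ℕ) : SimpleGraph (Fin n) :=
  SimpleGraph.fromRel fun i j =>
    (i : ℕ) < k ∨ ∃ t < p, (i : ℕ) = k + 2 * t ∧ (j : ℕ) = k + 2 * t + 1

/-- The matrix `J` with rows `(q - 1, n - q)` and `(q, δ - 1)`. -/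
def matrixJ (n q δ : ℕ) : Matrix (Fin 2) (Fin 2) ℝ :=
  !![(q : ℝ) - 1, (n : ℝ) - q; (q : ℝ), (δ : ℝ) - 1]

/-! Freeness is a count. Suppose `F` embeds in `S_{n,q}^1`, let `S` be the part of `A` mapped
outside the `q` dominating vertices and `T` the part of `B` mapped into them. Since `|A| = q + 1`,
`|S| > |T|`. Vertices of `S` have degree at least 2, and only one edge of `F` can use the extra
edge, so at least `2|S| - 1 ≥ |S| + |T|` edges join `S` to `T`: too many for a forest
(`free_splitGraph_one`). The lower bound on `spex` then follows from a test vector on this graph.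

For the upper bound, `ρ(J)` eventually exceeds `√(qn)`, so assume `ρ(G) ≥ √(qn)`. An `F`-free graph
is `d`-degenerate with `d = |F|`, hence sparse on every vertex set. Take a Perron vector with
maximum 1. Sparsity and the two-step eigenvalue equation bound the number of heavy vertices
(`card_heavy_mul_le`), then produce a set `L` of exactly `q` vertices of weight near 1 whose common
neighbourhood is almost everything, all other weights being small (`exists_dominating_set`). A
vertex outside `L` has fewer than `δ` neighbours in that common neighbourhood, since otherwise `F`
embeds with a minimum-degree vertex of `A` placed there (`isContained_of_card_le_card_filter`).

Finally the exceptional vertices, those outside `L` not joined to all of `L`, are joined to all of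
`L` and lose their other edges. Each gains an entry of weight at least 1/2 and loses only products
of small weights, so the quadratic form does not drop. The new matrix is bounded by `ρ(J)` through
the Schur test with the lifted eigenvector of `J` (`sum_sum_adj_le_of_dominating`). -/

/-! ### Spectral radius of symmetric matrices and graphs -/

/-- The largest eigenvalue of a real symmetric matrix lies in its spectrum. -/
theorem matrixRho_mem_spectrum {m : Type*} [Fintype m] [DecidableEq m] [Nonempty m]
    {M : Matrix m m ℝ} (hM : M.IsHermitian) : matrixRho M ∈ spectrum ℝ M := by
  refine Set.Nonempty.csSup_mem ?_ (Matrix.finite_real_spectrum (A := M))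
  exact ⟨_, hM.eigenvalues_mem_spectrum_real (Classical.arbitrary m)⟩

/-- `ρ(M) - M` is positive semidefinite for a real symmetric matrix `M`. -/
theorem posSemidef_matrixRho_sub {m : Type*} [Fintype m] [DecidableEq m]
    {M : Matrix m m ℝ} (hM : M.IsHermitian) :
    (algebraMap ℝ (Matrix m m ℝ) (matrixRho M) - M).PosSemidef := by
  rw [Matrix.posSemidef_iff_isHermitian_and_spectrum_nonneg]
  constructor
  · refine Matrix.IsHermitian.sub ?_ hM
    rw [Matrix.algebraMap_eq_diagonal]
    exact Matrix.isHermitian_diagonal _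
  · rw [← spectrum.singleton_sub_eq]
    rintro _ ⟨a, rfl, b, hb, rfl⟩
    exact sub_nonneg.2 (le_csSup (Matrix.finite_real_spectrum (A := M)).bddAbove hb)

open Matrix in
theorem dotProduct_mulVec_le_matrixRho {m : Type*} [Fintype m] [DecidableEq m]
    {M : Matrix m m ℝ} (hM : M.IsHermitian) (x : m → ℝ) :
    x ⬝ᵥ (M *ᵥ x) ≤ matrixRho M * (x ⬝ᵥ x) := by
  have h := (posSemidef_matrixRho_sub hM).dotProduct_mulVec_nonneg x
  rw [Matrix.sub_mulVec, dotProduct_sub, Algebra.algebraMap_eq_smul_one, Matrix.smul_mulVec,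
    Matrix.one_mulVec, dotProduct_smul] at h
  simpa using h

open Matrix in
/-- Perron–Frobenius for symmetric matrices: a symmetric matrix with nonnegative entries has a
nonnegative eigenvector for its largest eigenvalue. -/
theorem exists_nonneg_eigenvector {m : Type*} [Fintype m] [DecidableEq m] [Nonempty m]
    {M : Matrix m m ℝ} (hM : M.IsHermitian) (h0 : ∀ i j, 0 ≤ M i j) :
    ∃ x : m → ℝ, x ≠ 0 ∧ (∀ i, 0 ≤ x i) ∧ M *ᵥ x = matrixRho M • x := by
  have hmem := matrixRho_mem_spectrum hM
  rw [← Matrix.spectrum_toLin', ← Module.End.hasEigenvalue_iff_mem_spectrum] at hmem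
  obtain ⟨x, hx⟩ := hmem.exists_hasEigenvector
  have hx1 : M *ᵥ x = matrixRho M • x := by simpa using hx.apply_eq_smul
  refine ⟨fun i => |x i|, ?_, fun i => abs_nonneg _, ?_⟩
  · intro h
    apply hx.2
    ext i
    simpa using congrFun h i
  · set y : m → ℝ := fun i => |x i| with hy
    have hyy : y ⬝ᵥ y = x ⬝ᵥ x := by simp [hy, dotProduct]
    have h1 : x ⬝ᵥ (M *ᵥ x) ≤ y ⬝ᵥ (M *ᵥ y) := by
      simp only [dotProduct, Matrix.mulVec, Finset.mul_sum]
      refine Finset.sum_le_sum fun i _ => Finset.sum_le_sum fun j _ => ?_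
      calc x i * (M i j * x j) ≤ |x i * (M i j * x j)| := le_abs_self _
        _ = y i * (M i j * y j) := by
          simp [hy, abs_mul, abs_of_nonneg (h0 i j)]
    have h2 := dotProduct_mulVec_le_matrixRho hM y
    have h3 : x ⬝ᵥ (M *ᵥ x) = matrixRho M * (x ⬝ᵥ x) := by
      rw [hx1, dotProduct_smul, smul_eq_mul]
    have h4 : y ⬝ᵥ (M *ᵥ y) = matrixRho M * (y ⬝ᵥ y) := by
      rw [hyy] at h2 ⊢; linarith
    -- Taking absolute values cannot lower the quadratic form, so `y` attains the maximum; a zero of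
    -- a positive semidefinite form lies in its kernel.
    have h5 := ((posSemidef_matrixRho_sub hM).dotProduct_mulVec_zero_iff y).1 (by
      rw [Matrix.sub_mulVec, dotProduct_sub, Algebra.algebraMap_eq_smul_one, Matrix.smul_mulVec,
        Matrix.one_mulVec, dotProduct_smul]
      simpa [sub_eq_zero] using h4.symm)
    rw [Matrix.sub_mulVec, Algebra.algebraMap_eq_smul_one, Matrix.smul_mulVec,
      Matrix.one_mulVec, sub_eq_zero] at h5
    exact h5.symm

/-- The Schur test for symmetric nonnegative matrices. -/
theorem sum_sum_mul_le_of_mulVec_le {m : Type*} [Fintype m] {M : m → m → ℝ} {lam : ℝ} {y : m → ℝ}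
    (hM : ∀ i j, M i j = M j i) (h0 : ∀ i j, 0 ≤ M i j) (hy : ∀ i, 0 < y i)
    (h : ∀ i, ∑ j, M i j * y j ≤ lam * y i) (x : m → ℝ) :
    ∑ i, ∑ j, M i j * (x i * x j) ≤ lam * ∑ i, x i ^ 2 := by
  -- Weighted AM-GM with ratio `y j / y i`; the deficit is a multiple of a square.
  have key : ∀ i j, 2 * (M i j * (x i * x j)) ≤
      M i j * y j * (x i ^ 2 / y i) + M j i * y i * (x j ^ 2 / y j) := by
    intro i j
    rw [hM j i]
    have hi := hy i
    have hj := hy j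
    have : M i j * y j * (x i ^ 2 / y i) + M i j * y i * (x j ^ 2 / y j) -
        2 * (M i j * (x i * x j)) = M i j * ((x i * y j - x j * y i) ^ 2 / (y i * y j)) := by
      field_simp
      ring
    have h2 : 0 ≤ M i j * ((x i * y j - x j * y i) ^ 2 / (y i * y j)) :=
      mul_nonneg (h0 i j) (by positivity)
    linarith
  have e1 : ∑ i, ∑ j, M i j * y j * (x i ^ 2 / y i) ≤ lam * ∑ i, x i ^ 2 := by
    rw [Finset.mul_sum]
    refine Finset.sum_le_sum fun i _ => ?_
    rw [← Finset.sum_mul]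
    have hi := hy i
    calc _ ≤ lam * y i * (x i ^ 2 / y i) := by
          exact mul_le_mul_of_nonneg_right (h i) (by positivity)
      _ = lam * x i ^ 2 := by field_simp
  have e2 : ∑ i, ∑ j, M j i * y i * (x j ^ 2 / y j) = ∑ i, ∑ j, M i j * y j * (x i ^ 2 / y i) :=
    Finset.sum_comm
  have e3 := Finset.sum_le_sum fun i (_ : i ∈ Finset.univ) =>
    Finset.sum_le_sum fun j (_ : j ∈ Finset.univ) => key i j
  simp only [Finset.sum_add_distrib, ← Finset.mul_sum] at e3
  linarith

/-- A nonnegative eigenvector of a graph for its spectral radius, scaled to have maximum `1`. -/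
theorem exists_perron_vector {W : Type*} [Fintype W] [Nonempty W] (G : SimpleGraph W)
    [DecidableRel G.Adj] :
    ∃ x : W → ℝ, (∀ v, 0 ≤ x v) ∧ (∀ v, x v ≤ 1) ∧ (∃ z, x z = 1) ∧
      ∀ v, graphRho G * x v = ∑ w ∈ G.neighborFinset v, x w := by
  classical
  obtain ⟨x, hx0, hx, hxe⟩ := exists_nonneg_eigenvector (M := G.adjMatrix ℝ)
    (by ext i j; simp [SimpleGraph.adjMatrix_apply, G.adj_comm])
    (fun i j => by rw [SimpleGraph.adjMatrix_apply]; split_ifs <;> norm_num)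
  have hrho : graphRho G = matrixRho (G.adjMatrix ℝ) := by
    unfold graphRho
    congr!
  obtain ⟨z, hz⟩ := Finite.exists_max x
  have hzpos : 0 < x z := by
    refine (hx z).lt_of_ne fun h => hx0 ?_
    ext i
    exact le_antisymm ((hz i).trans_eq h.symm) (hx i)
  refine ⟨fun v => x v / x z, fun v => div_nonneg (hx v) hzpos.le,
    fun v => (div_le_one hzpos).2 (hz v), ⟨z, div_self hzpos.ne'⟩, fun v => ?_⟩
  have := congrFun hxe v
  rw [SimpleGraph.adjMatrix_mulVec_apply] at this
  rw [← Finset.sum_div, this, hrho, Pi.smul_apply, smul_eq_mul, mul_div_assoc]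

/-- A lower bound for the spectral radius from a nonnegative test vector. -/
theorem le_graphRho_of_le_sum {W : Type*} [Fintype W] (G : SimpleGraph W) [DecidableRel G.Adj]
    {lam : ℝ} {x : W → ℝ} (hx : ∀ v, 0 ≤ x v) (hx0 : ∃ v, x v ≠ 0)
    (h : ∀ v, lam * x v ≤ ∑ w ∈ G.neighborFinset v, x w) : lam ≤ graphRho G := by
  classical
  have hrho : graphRho G = matrixRho (G.adjMatrix ℝ) := by
    unfold graphRho
    congr!
  have h1 := dotProduct_mulVec_le_matrixRho (M := G.adjMatrix ℝ)
    (by ext i j; simp [SimpleGraph.adjMatrix_apply, G.adj_comm]) x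
  have hpos : 0 < dotProduct x x := by
    obtain ⟨v, hv⟩ := hx0
    exact Finset.sum_pos' (fun i _ => mul_self_nonneg _) ⟨v, Finset.mem_univ _, mul_self_pos.2 hv⟩
  have h2 : lam * dotProduct x x ≤ dotProduct x ((G.adjMatrix ℝ).mulVec x) := by
    simp only [dotProduct, Finset.mul_sum]
    refine Finset.sum_le_sum fun v _ => ?_
    rw [SimpleGraph.adjMatrix_mulVec_apply]
    calc lam * (x v * x v) = x v * (lam * x v) := by ring
      _ ≤ _ := mul_le_mul_of_nonneg_left (h v) (hx v)
  rw [hrho]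
  exact le_of_mul_le_mul_right (h2.trans h1) hpos

/-- `J` is not symmetric, so its spectrum is read off from the factored characteristic polynomial;
`q ≤ n` keeps the discriminant nonnegative. -/
theorem matrixRho_matrixJ (n q δ : ℕ) (hn : q ≤ n) :
    matrixRho (matrixJ n q δ) =
      ((q : ℝ) + δ - 2) / 2 + √(((q : ℝ) - δ) ^ 2 / 4 + q * (n - q)) := by
  set s := √(((q : ℝ) - δ) ^ 2 / 4 + q * (n - q)) with hs
  have hn' : (q : ℝ) ≤ n := by exact_mod_cast hn
  have hss : s * s = ((q : ℝ) - δ) ^ 2 / 4 + q * (n - q) :=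
    Real.mul_self_sqrt (add_nonneg (by positivity) (mul_nonneg (by positivity) (by linarith)))
  have hs0 : 0 ≤ s := Real.sqrt_nonneg _
  have hspec : ∀ r : ℝ, r ∈ spectrum ℝ (matrixJ n q δ) ↔
      (r - (((q : ℝ) + δ - 2) / 2 + s)) * (r - (((q : ℝ) + δ - 2) / 2 - s)) = 0 := by
    intro r
    rw [spectrum.mem_iff, Matrix.isUnit_iff_isUnit_det, isUnit_iff_ne_zero, not_not]
    have : (algebraMap ℝ (Matrix (Fin 2) (Fin 2) ℝ) r - matrixJ n q δ).det =
        (r - (((q : ℝ) + δ - 2) / 2 + s)) * (r - (((q : ℝ) + δ - 2) / 2 - s)) := by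
      rw [Matrix.det_fin_two]
      simp [matrixJ, Matrix.algebraMap_matrix_apply]
      linear_combination hss
    rw [this]
  unfold matrixRho
  refine IsGreatest.csSup_eq ⟨(hspec _).2 (by ring), fun r hr => ?_⟩
  rcases mul_eq_zero.1 ((hspec r).1 hr) with h | h <;> linarith

/-! ### Degeneracy of tree-free graphs -/

/-- A tree embeds greedily into any nonempty vertex set inducing a subgraph of large minimum
degree. -/
theorem SimpleGraph.IsTree.exists_copy_of_le_card_filter {W : Type*} {G : SimpleGraph W}
    [DecidableRel G.Adj] {S : Finset W} (hS : S.Nonempty) (k : ℕ)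
    (hdeg : ∀ w ∈ S, k ≤ (S.filter (G.Adj w)).card) :
    ∀ (l : ℕ) {V : Type*} [Fintype V] {F : SimpleGraph V}, F.IsTree → Fintype.card V = l →
      l ≤ k → ∃ f : V → W, Function.Injective f ∧ (∀ a, f a ∈ S) ∧
        ∀ a b, F.Adj a b → G.Adj (f a) (f b) := by
  classical
  intro l
  induction l with
  | zero =>
    intro V _ F hF hc _
    have := hF.connected.nonempty
    exact absurd hc Fintype.card_ne_zero
  | succ l ih =>
    intro V _ F hF hc hlk
    have hne := hF.connected.nonempty
    rcases subsingleton_or_nontrivial V with hsub | hnt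
    · obtain ⟨w, hw⟩ := hS
      refine ⟨fun _ => w, fun a b _ => Subsingleton.elim a b, fun _ => hw, fun a b hab => ?_⟩
      exact absurd (Subsingleton.elim a b) hab.ne
    · obtain ⟨v, hv⟩ := hF.exists_vert_degree_one_of_nontrivial
      have hF' : (F.induce {v}ᶜ).IsTree :=
        ⟨hF.connected.induce_compl_singleton_of_degree_eq_one hv, hF.isAcyclic.induce _⟩
      have hc' : Fintype.card ({v}ᶜ : Set V) = l := by
        rw [Fintype.card_compl_set, hc]
        simp
      obtain ⟨f, hfi, hfS, hfa⟩ := ih hF' hc' (by omega)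
      obtain ⟨u, hu, huniq⟩ := F.degree_eq_one_iff_existsUnique_adj.1 hv
      have huv : u ∈ ({v}ᶜ : Set V) := by simpa using hu.ne'
      -- The deleted leaf needs an unused neighbour of the image of `u`: only `l < k` vertices are
      -- occupied.
      have hlt : (Finset.univ.image f).card < (S.filter (G.Adj (f ⟨u, huv⟩))).card := by
        calc (Finset.univ.image f).card ≤ l := by
              rw [← hc']; exact Finset.card_image_le
          _ < k := by omega
          _ ≤ _ := hdeg _ (hfS _)
      obtain ⟨w, hw, hwf⟩ := Finset.exists_mem_notMem_of_card_lt_card hlt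
      have hwf' : ∀ a, f a ≠ w := fun a h =>
        hwf (Finset.mem_image.2 ⟨a, Finset.mem_univ _, h⟩)
      rw [Finset.mem_filter] at hw
      refine ⟨fun a => if h : a = v then w else f ⟨a, h⟩, ?_, ?_, ?_⟩
      · intro a b hab
        by_cases ha : a = v <;> by_cases hb : b = v
        · rw [ha, hb]
        · simp only [ha, hb, dite_true, dite_false] at hab
          exact absurd hab.symm (hwf' _)
        · simp only [ha, hb, dite_true, dite_false] at hab
          exact absurd hab (hwf' _)
        · simp only [ha, hb, dite_false] at hab
          exact congrArg Subtype.val (hfi hab)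
      · intro a
        by_cases ha : a = v
        · simpa [ha] using hw.1
        · simpa [ha] using hfS _
      · intro a b hab
        by_cases ha : a = v <;> by_cases hb : b = v
        · exact absurd (ha.trans hb.symm) hab.ne
        · have hbu : b = u := huniq b (ha ▸ hab)
          subst hbu
          simpa [ha, hb] using hw.2.symm
        · have hau : a = u := huniq a (hb ▸ hab.symm)
          subst hau
          simpa [ha, hb] using hw.2
        · simpa [ha, hb] using hfa ⟨a, ha⟩ ⟨b, hb⟩ (by simpa using hab)

/-- In a graph without a copy of the tree `F`, every nonempty vertex set contains a vertex with
fewer than `|F|` neighbours in the set. -/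
theorem SimpleGraph.IsTree.exists_card_filter_le_of_free {V W : Type*} [Fintype V]
    {F : SimpleGraph V} (hF : F.IsTree) {G : SimpleGraph W} [DecidableRel G.Adj] (hG : F.Free G)
    {S : Finset W} (hS : S.Nonempty) :
    ∃ v ∈ S, (S.filter (G.Adj v)).card ≤ Fintype.card V := by
  by_contra! hcon
  obtain ⟨f, hfi, -, hfa⟩ := SimpleGraph.IsTree.exists_copy_of_le_card_filter hS (Fintype.card V)
    (fun w hw => (hcon w hw).le) _ hF rfl le_rfl
  exact hG ⟨⟨⟨f, fun {a b} h => hfa a b h⟩, hfi⟩⟩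

/-- Weighted edge count of a degenerate graph. -/
theorem sum_sum_adj_le_of_degenerate {W : Type*} {G : SimpleGraph W} [DecidableRel G.Adj]
    {d : ℕ} (hd : ∀ S : Finset W, S.Nonempty → ∃ v ∈ S, (S.filter (G.Adj v)).card ≤ d)
    {x : W → ℝ} {c : ℝ} (S : Finset W) (hx : ∀ v ∈ S, 0 ≤ x v) (hc : ∀ v ∈ S, x v ≤ c) :
    ∑ u ∈ S, ∑ w ∈ S, (if G.Adj u w then x u * x w else 0) ≤ 2 * d * c * ∑ u ∈ S, x u := by
  classical
  induction S using Finset.strongInduction with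
  | H S ih =>
    rcases S.eq_empty_or_nonempty with rfl | hS
    · simp
    obtain ⟨v, hv, hvd⟩ := hd S hS
    have hih := ih (S.erase v) (Finset.erase_ssubset hv)
      (fun u hu => hx u (Finset.mem_of_mem_erase hu)) (fun u hu => hc u (Finset.mem_of_mem_erase hu))
    have hc0 : 0 ≤ c := (hx v hv).trans (hc v hv)
    have hsum : ∑ w ∈ S.erase v, (if G.Adj v w then x v * x w else 0) ≤ d * c * x v := by
      have h1 : ∑ w ∈ S.erase v, (if G.Adj v w then x v * x w else 0) ≤
          ∑ w ∈ S, (if G.Adj v w then x v * c else 0) := by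
        refine (Finset.sum_le_sum_of_subset_of_nonneg (Finset.erase_subset v S) ?_).trans
          (Finset.sum_le_sum ?_)
        · intro w hw _
          split_ifs
          · exact mul_nonneg (hx v hv) (hx w hw)
          · rfl
        · intro w hw
          split_ifs
          · exact mul_le_mul_of_nonneg_left (hc w hw) (hx v hv)
          · rfl
      rw [← Finset.sum_filter (s := S) (p := G.Adj v) (f := fun _ => x v * c), Finset.sum_const,
        nsmul_eq_mul] at h1
      have h2 : ((S.filter (G.Adj v)).card : ℝ) ≤ d := by exact_mod_cast hvd
      calc _ ≤ _ := h1
        _ ≤ d * (x v * c) := mul_le_mul_of_nonneg_right h2 (mul_nonneg (hx v hv) hc0)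
        _ = d * c * x v := by ring
    -- Ordered pairs are summed, so the edges at the erased vertex count twice; this is the 2 in the
    -- bound.
    have hsplit : ∑ u ∈ S, ∑ w ∈ S, (if G.Adj u w then x u * x w else 0) =
        ∑ u ∈ S.erase v, ∑ w ∈ S.erase v, (if G.Adj u w then x u * x w else 0) +
          2 * ∑ w ∈ S.erase v, (if G.Adj v w then x v * x w else 0) := by
      rw [← Finset.add_sum_erase S _ hv, ← Finset.add_sum_erase S _ hv]
      have h3 : ∀ u ∈ S.erase v, ∑ w ∈ S, (if G.Adj u w then x u * x w else 0) =
          (if G.Adj v u then x v * x u else 0) +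
            ∑ w ∈ S.erase v, (if G.Adj u w then x u * x w else 0) := by
        intro u _
        rw [← Finset.add_sum_erase S _ hv]
        simp only [G.adj_comm u v, mul_comm (x u) (x v)]
      rw [Finset.sum_congr rfl h3, Finset.sum_add_distrib]
      simp
      ring
    rw [hsplit, ← Finset.add_sum_erase S _ hv]
    linarith

theorem sum_card_filter_adj_le_of_degenerate {W : Type*} {G : SimpleGraph W} [DecidableRel G.Adj]
    {d : ℕ} (hd : ∀ S : Finset W, S.Nonempty → ∃ v ∈ S, (S.filter (G.Adj v)).card ≤ d)
    (S : Finset W) : ∑ u ∈ S, ((S.filter (G.Adj u)).card : ℝ) ≤ 2 * d * S.card := by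
  have h := sum_sum_adj_le_of_degenerate hd (x := fun _ => 1) (c := 1) S
    (fun _ _ => zero_le_one) (fun _ _ => le_rfl)
  simpa using h

/-! ### Embedding the tree around `q` dominating vertices -/

theorem Finset.exists_injOn_of_card_le {α β : Type*} [Nonempty β] {s : Finset α} {t : Finset β}
    (h : s.card ≤ t.card) : ∃ f : α → β, (∀ a ∈ s, f a ∈ t) ∧ Set.InjOn f s := by
  obtain ⟨f, hf, hi⟩ := s.finite_toSet.exists_injOn_of_encard_le (t := (t : Set β))
    (by simpa [Set.encard_coe_eq_coe_finsetCard] using h)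
  exact ⟨f, fun a ha => hf ha, hi⟩

/-- If `q` vertices are completely joined to a large set `R`, then a further vertex with `δ`
neighbours in `R` completes a copy of `F`. -/
theorem isContained_of_card_le_card_filter {V W : Type*} [Fintype V] {F : SimpleGraph V}
    [DecidableRel F.Adj] {A B : Finset V} (hAB : F.IsBipartiteWith (A : Set V) (B : Set V))
    (hcover : ∀ v, v ∈ A ∨ v ∈ B) {q δ : ℕ} (hq : A.card = q + 1) (hq1 : 1 ≤ q) {a₀ : V}
    (ha₀ : a₀ ∈ A) (hδ : F.degree a₀ = δ) {G : SimpleGraph W} [DecidableRel G.Adj]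
    {L R : Finset W} (hL : L.card = q) (hLR : ∀ u ∈ L, ∀ w ∈ R, G.Adj u w) {v : W} (hv : v ∉ L)
    (hvR : δ ≤ (R.filter (G.Adj v)).card) (hR : Fintype.card V ≤ R.card) : F.IsContained G := by
  classical
  have hne : Nonempty W := ⟨v⟩
  have hdisj : ∀ a, a ∈ A → a ∉ B := fun a ha hb =>
    Set.disjoint_left.1 hAB.disjoint (Finset.mem_coe.2 ha) (Finset.mem_coe.2 hb)
  have hAdjB : ∀ a b, F.Adj a b → a ∈ A → b ∈ B := fun a b hab ha => by
    have := hAB.mem_of_mem_adj (Finset.mem_coe.2 ha) hab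
    simpa using this
  have hcardV : A.card + B.card = Fintype.card V := by
    rw [← Finset.card_union_of_disjoint (Finset.disjoint_left.2 hdisj), ← Finset.card_univ]
    congr 1
    ext a
    simpa using hcover a
  have hNB : F.neighborFinset a₀ ⊆ B := fun b hb => hAdjB a₀ b (by simpa using hb) ha₀
  obtain ⟨e₁, he₁, hi₁⟩ := Finset.exists_injOn_of_card_le (s := A.erase a₀) (t := L)
    (by rw [Finset.card_erase_of_mem ha₀]; omega)
  obtain ⟨e₂, he₂, hi₂⟩ := Finset.exists_injOn_of_card_le (s := F.neighborFinset a₀)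
    (t := R.filter (G.Adj v)) (by rw [F.card_neighborFinset_eq_degree, hδ]; exact hvR)
  set T := (F.neighborFinset a₀).image e₂ with hT
  have hTc : T.card ≤ δ := Finset.card_image_le.trans (by rw [F.card_neighborFinset_eq_degree, hδ])
  -- `v` may itself lie in `R`, hence the erasure; the lost place is affordable because `|R| ≥ |A| +
  -- |B|` and `A` is nonempty.
  obtain ⟨e₃, he₃, hi₃⟩ := Finset.exists_injOn_of_card_le (s := B \ F.neighborFinset a₀)
    (t := (R \ T).erase v) (by
      rw [Finset.card_sdiff_of_subset hNB, F.card_neighborFinset_eq_degree, hδ]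
      have h1 := Finset.pred_card_le_card_erase (s := R \ T) (a := v)
      have h2 := Finset.le_card_sdiff T R
      omega)
  have hLR' : ∀ u ∈ L, u ∉ R := fun u hu hR' => G.irrefl (hLR u hu u hR')
  set f : V → W := fun a => if a = a₀ then v else if a ∈ A then e₁ a else
    if F.Adj a₀ a then e₂ a else e₃ a with hf
  have f0 : f a₀ = v := by simp [hf]
  have f1 : ∀ a ∈ A, a ≠ a₀ → f a = e₁ a := fun a ha hne => by simp [hf, ha, hne]
  have f2 : ∀ b ∈ B, F.Adj a₀ b → f b = e₂ b := fun b hb hab => by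
    have h1 : b ∉ A := fun h => hdisj b h hb
    have h2 : b ≠ a₀ := hab.ne'
    simp [hf, h1, h2, hab]
  have f3 : ∀ b ∈ B, ¬ F.Adj a₀ b → f b = e₃ b := fun b hb hab => by
    have h1 : b ∉ A := fun h => hdisj b h hb
    have h2 : b ≠ a₀ := fun h => h1 (h ▸ ha₀)
    simp [hf, h1, h2, hab]
  have m1 : ∀ a ∈ A, a ≠ a₀ → e₁ a ∈ L := fun a ha hne => he₁ a (Finset.mem_erase.2 ⟨hne, ha⟩)
  have m2 : ∀ b, F.Adj a₀ b → e₂ b ∈ R ∧ G.Adj v (e₂ b) ∧ e₂ b ∈ T := fun b hab => by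
    have hb : b ∈ F.neighborFinset a₀ := by simpa using hab
    have := Finset.mem_filter.1 (he₂ b hb)
    exact ⟨this.1, this.2, Finset.mem_image_of_mem _ hb⟩
  have m3 : ∀ b ∈ B, ¬ F.Adj a₀ b → e₃ b ∈ R ∧ e₃ b ∉ T ∧ e₃ b ≠ v := fun b hb hab => by
    have := he₃ b (by simp [hb, hab])
    simp only [Finset.mem_erase, Finset.mem_sdiff] at this
    exact ⟨this.2.1, this.2.2, this.1⟩
  have fB : ∀ b ∈ B, f b ∈ R ∧ f b ≠ v := fun b hb => by
    by_cases hab : F.Adj a₀ b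
    · rw [f2 b hb hab]
      exact ⟨(m2 b hab).1, (m2 b hab).2.1.ne'⟩
    · rw [f3 b hb hab]
      exact ⟨(m3 b hb hab).1, (m3 b hb hab).2.2⟩
  have fA : ∀ a ∈ A, a = a₀ ∧ f a = v ∨ a ≠ a₀ ∧ f a = e₁ a ∧ f a ∈ L := fun a ha => by
    by_cases h : a = a₀
    · exact Or.inl ⟨h, h ▸ f0⟩
    · exact Or.inr ⟨h, f1 a ha h, f1 a ha h ▸ m1 a ha h⟩
  have hABne : ∀ a ∈ A, ∀ b ∈ B, f a ≠ f b := fun a ha b hb h => by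
    rcases fA a ha with ⟨-, h1⟩ | ⟨-, -, h1⟩
    · exact (fB b hb).2 (h ▸ h1)
    · exact hLR' _ h1 (h ▸ (fB b hb).1)
  have hAinj : ∀ a ∈ A, ∀ b ∈ A, f a = f b → a = b := fun a ha b hb h => by
    rcases fA a ha with ⟨h1, h2⟩ | ⟨h1, h2, h3⟩ <;> rcases fA b hb with ⟨k1, k2⟩ | ⟨k1, k2, k3⟩
    · rw [h1, k1]
    · exact absurd (h2 ▸ h ▸ k3) hv
    · exact absurd (k2 ▸ h ▸ h3) hv
    · exact hi₁ (by simp [h1, ha]) (by simp [k1, hb]) (by rw [← h2, ← k2, h])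
  have hBinj : ∀ a ∈ B, ∀ b ∈ B, f a = f b → a = b := fun a ha b hb h => by
    by_cases h1 : F.Adj a₀ a <;> by_cases h2 : F.Adj a₀ b
    · rw [f2 a ha h1, f2 b hb h2] at h
      exact hi₂ (by simpa using h1) (by simpa using h2) h
    · rw [f2 a ha h1, f3 b hb h2] at h
      exact absurd (h ▸ (m2 a h1).2.2) (m3 b hb h2).2.1
    · rw [f3 a ha h1, f2 b hb h2] at h
      exact absurd (h ▸ (m2 b h2).2.2) (m3 a ha h1).2.1
    · rw [f3 a ha h1, f3 b hb h2] at h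
      exact hi₃ (by simp [ha, h1]) (by simp [hb, h2]) h
  have hinj : Function.Injective f := fun a b h => by
    rcases hcover a with ha | ha <;> rcases hcover b with hb | hb
    · exact hAinj a ha b hb h
    · exact absurd h (hABne a ha b hb)
    · exact absurd h.symm (hABne b hb a ha)
    · exact hBinj a ha b hb h
  have hadj : ∀ a ∈ A, ∀ b, F.Adj a b → G.Adj (f a) (f b) := fun a ha b hab => by
    have hb := hAdjB a b hab ha
    rcases fA a ha with ⟨rfl, h2⟩ | ⟨h1, h2, h3⟩
    · rw [h2, f2 b hb hab]
      exact (m2 b hab).2.1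
    · exact hLR _ h3 _ (fB b hb).1
  refine ⟨⟨⟨f, fun {a b} hab => ?_⟩, hinj⟩⟩
  rcases hcover a with ha | ha
  · exact hadj a ha b hab
  · rcases hcover b with hb | hb
    · exact (hadj b hb a hab.symm).symm
    · have := hAB.mem_of_adj hab
      rcases this with h | h
      · exact absurd ha (hdisj a (by simpa using h.1))
      · exact absurd hb (hdisj b (by simpa using h.2))

/-! ### Edge counts in forests and freeness of `S_{n,q}^1` -/

/-- A forest on a nonempty vertex set has fewer edges than vertices. -/
theorem SimpleGraph.IsAcyclic.card_edgeFinset_lt {V : Type*} [Fintype V] [Nonempty V]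
    {H : SimpleGraph V} [Fintype H.edgeSet] (hH : H.IsAcyclic) :
    H.edgeFinset.card < Fintype.card V := by
  classical
  obtain ⟨T, hHT, -, hT⟩ := SimpleGraph.connected_top.exists_isTree_le_of_le_of_isAcyclic
    (le_top (a := H)) hH
  have h1 := hT.card_edgeFinset
  have h2 := Finset.card_le_card (SimpleGraph.edgeFinset_mono hHT)
  omega

/-- In a forest, the number of edges between two disjoint sets, the first nonempty, is less than
the number of vertices of their union. -/
theorem SimpleGraph.IsAcyclic.sum_card_filter_lt {V : Type*} [Fintype V] [DecidableEq V]
    {F : SimpleGraph V} [DecidableRel F.Adj] (hF : F.IsAcyclic) {S T : Finset V}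
    (hST : Disjoint S T) (hS : S.Nonempty) :
    ∑ a ∈ S, (T.filter (F.Adj a)).card < S.card + T.card := by
  classical
  set U : Set V := ((S ∪ T : Finset V) : Set V) with hU
  have hne : Nonempty U := by
    obtain ⟨s, hs⟩ := hS
    exact ⟨⟨s, by simp [hU, hs]⟩⟩
  have h1 := (hF.induce U).card_edgeFinset_lt
  have hUc : Fintype.card U = S.card + T.card := by
    rw [← Finset.card_union_of_disjoint hST]
    simp [hU]
  set P : Finset (V × V) := (S ×ˢ T).filter fun p => F.Adj p.1 p.2 with hP
  have hPc : P.card = ∑ a ∈ S, (T.filter (F.Adj a)).card := by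
    rw [hP, Finset.card_filter, Finset.sum_product]
    exact Finset.sum_congr rfl fun a _ => (Finset.card_filter _ _).symm
  have hPi : (P.image fun p => s(p.1, p.2)).card = P.card := by
    refine Finset.card_image_of_injOn ?_
    rintro ⟨a, b⟩ hab ⟨a', b'⟩ hab' h
    simp only [hP, Finset.coe_filter, Finset.mem_product, Set.mem_ofPred_eq] at hab hab'
    simp only [Sym2.eq_iff] at h
    rcases h with h | h
    · exact Prod.ext h.1 h.2
    · exact absurd hab.1.1 (fun h' => Finset.disjoint_left.1 hST h' (h.1 ▸ hab'.1.2))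
  have hsub : (P.image fun p => s(p.1, p.2)) ⊆
      (F.induce U).edgeFinset.image (Sym2.map Subtype.val) := by
    intro e he
    obtain ⟨⟨a, b⟩, hab, rfl⟩ := Finset.mem_image.1 he
    simp only [hP, Finset.mem_filter, Finset.mem_product] at hab
    refine Finset.mem_image.2 ⟨s(⟨a, by simp [hU, hab.1.1]⟩, ⟨b, by simp [hU, hab.1.2]⟩), ?_, rfl⟩
    simpa using hab.2
  have h2 := (Finset.card_le_card hsub).trans Finset.card_image_le
  omega

theorem splitGraph_one_adj {n q : ℕ} {i j : Fin n} : (splitGraph n q 1).Adj i j ↔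
    i ≠ j ∧ (((i : ℕ) < q ∨ (i : ℕ) = q ∧ (j : ℕ) = q + 1) ∨
      ((j : ℕ) < q ∨ (j : ℕ) = q ∧ (i : ℕ) = q + 1)) := by
  simp [splitGraph, SimpleGraph.fromRel_adj]

/-- A tree with one side `A` of size `q + 1`, all of whose vertices in `A` have degree at least
two, is not contained in `S_{n,q}^1`. -/
theorem free_splitGraph_one {V : Type*} [Fintype V] {F : SimpleGraph V} [DecidableRel F.Adj]
    (hF : F.IsTree) {A B : Finset V} (hAB : F.IsBipartiteWith (A : Set V) (B : Set V))
    {q : ℕ} (hq : A.card = q + 1)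
    (hdeg : ∀ a ∈ A, 2 ≤ F.degree a) (n : ℕ) : F.Free (splitGraph n q 1) := by
  classical
  rintro ⟨f⟩
  have hdisj : ∀ a, a ∈ A → a ∉ B := fun a ha hb =>
    Set.disjoint_left.1 hAB.disjoint (Finset.mem_coe.2 ha) (Finset.mem_coe.2 hb)
  have hAdjB : ∀ a b, F.Adj a b → a ∈ A → b ∈ B := fun a b hab ha => by
    simpa using hAB.mem_of_mem_adj (Finset.mem_coe.2 ha) hab
  have hfi : ∀ a b, (f a : ℕ) = (f b : ℕ) → a = b := fun a b h => f.injective (Fin.ext h)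
  have hfadj : ∀ a b, F.Adj a b → (splitGraph n q 1).Adj (f a) (f b) := fun a b h =>
    f.toHom.map_adj h
  have hC : (Finset.univ.filter fun v => (f v : ℕ) < q).card ≤ q := by
    calc _ ≤ (Finset.range q).card := Finset.card_le_card_of_injOn (fun v => (f v : ℕ))
          (fun v hv => by simpa using hv) (fun a _ b _ h => hfi a b h)
      _ = q := Finset.card_range q
  have hAC := Finset.card_filter_add_card_filter_not (s := A) (fun v => (f v : ℕ) < q)
  have hABC : (A.filter fun v => (f v : ℕ) < q).card + (B.filter fun v => (f v : ℕ) < q).card ≤ q := by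
    rw [← Finset.card_union_of_disjoint]
    · exact (Finset.card_le_card fun v hv => by simp at hv ⊢; tauto).trans hC
    · rw [Finset.disjoint_left]
      intro v hv hv'
      exact hdisj v (Finset.mem_filter.1 hv).1 (Finset.mem_filter.1 hv').1
  set S := A.filter fun v => ¬ (f v : ℕ) < q with hS
  set T := B.filter fun v => (f v : ℕ) < q with hT
  set T' := B.filter fun v => ¬ (f v : ℕ) < q with hT'
  have hlt := hF.isAcyclic.sum_card_filter_lt (S := S) (T := T)
    (Finset.disjoint_left.2 fun v hv hv' =>
      hdisj v (Finset.mem_filter.1 hv).1 (Finset.mem_filter.1 hv').1)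
    (Finset.card_pos.1 (by omega))
  have hdeg' : ∀ a ∈ S, 2 ≤ (T.filter (F.Adj a)).card + (T'.filter (F.Adj a)).card := by
    intro a ha
    have haA := (Finset.mem_filter.1 ha).1
    have h1 := hdeg a haA
    rw [← F.card_neighborFinset_eq_degree] at h1
    refine h1.trans ((Finset.card_le_card ?_).trans (Finset.card_union_le _ _))
    intro b hb
    have hab : F.Adj a b := by simpa using hb
    have := hAdjB a b hab haA
    by_cases h : (f b : ℕ) < q
    · exact Finset.mem_union_left _ (by simp [hT, this, h, hab])
    · exact Finset.mem_union_right _ (by simp [hT', this, hab]; omega)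
  have hone : ∑ a ∈ S, (T'.filter (F.Adj a)).card ≤ 1 := by
    have hPc : ((S ×ˢ T').filter fun p => F.Adj p.1 p.2).card =
        ∑ a ∈ S, (T'.filter (F.Adj a)).card := by
      rw [Finset.card_filter, Finset.sum_product]
      exact Finset.sum_congr rfl fun a _ => (Finset.card_filter _ _).symm
    rw [← hPc, Finset.card_le_one]
    rintro ⟨a, b⟩ hab ⟨a', b'⟩ hab'
    simp only [hS, hT', Finset.mem_filter, Finset.mem_product] at hab hab'
    obtain ⟨⟨⟨ha, ha1⟩, hb, hb1⟩, hadj⟩ := hab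
    obtain ⟨⟨⟨ha', ha1'⟩, hb', hb1'⟩, hadj'⟩ := hab'
    have h1 := (splitGraph_one_adj.1 (hfadj _ _ hadj)).2
    have h2 := (splitGraph_one_adj.1 (hfadj _ _ hadj')).2
    -- Excludes two edges of `F` running along the extra edge in opposite directions, which would
    -- identify a vertex of `A` with one of `B`.
    have n1 : (f a : ℕ) ≠ f b' := fun h => hdisj a ha (hfi _ _ h ▸ hb')
    have e1 := hfi a a' (by omega)
    have e2 := hfi b b' (by omega)
    rw [e1, e2]
  -- Now `2|S| ≤ (|S| + |T| - 1) + 1`, so `|S| ≤ |T|`, against `|S| ≥ |T| + 1` from `hAC` and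
  -- `hABC`.
  have hsum := Finset.sum_le_sum hdeg'
  rw [Finset.sum_add_distrib, Finset.sum_const, smul_eq_mul] at hsum
  omega

/-! ### Lower bound for `spex` and asymptotics of `ρ(J)` -/

/-- There are finitely many graphs on `Fin n`. Without boundedness the supremum would take a default
value. -/
theorem bddAbove_spex {V : Type*} (n : ℕ) (F : SimpleGraph V) :
    BddAbove {r : ℝ | ∃ G : SimpleGraph (Fin n), F.Free G ∧ graphRho G = r} := by
  refine ((Set.finite_range fun G : SimpleGraph (Fin n) => graphRho G).subset ?_).bddAbove
  rintro r ⟨G, -, rfl⟩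
  exact ⟨G, rfl⟩

theorem lt_graphRho_splitGraph_one {n q : ℕ} (hq : 1 ≤ q) (hn : q + 2 ≤ n) :
    ((q : ℝ) - 1) / 2 + √((q : ℝ) * n - (3 * (q : ℝ) ^ 2 + 2 * q + 1) / 4) <
      graphRho (splitGraph n q 1) := by
  classical
  have hq' : (1 : ℝ) ≤ q := by exact_mod_cast hq
  have hn' : (q : ℝ) + 2 ≤ n := by exact_mod_cast hn
  -- With `-1` in place of `+1` this gives the exact spectral radius of the join without the extra
  -- edge. Strictness comes from this gap; the extra edge is simply discarded.
  set s := √((q : ℝ) * n - (3 * (q : ℝ) ^ 2 + 2 * q - 1) / 4) with hs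
  have h0 : 0 ≤ (q : ℝ) * n - (3 * (q : ℝ) ^ 2 + 2 * q + 1) / 4 := by nlinarith
  have hlt : √((q : ℝ) * n - (3 * (q : ℝ) ^ 2 + 2 * q + 1) / 4) < s :=
    Real.sqrt_lt_sqrt h0 (by linarith)
  have hss : s * s = (q : ℝ) * n - (3 * (q : ℝ) ^ 2 + 2 * q - 1) / 4 :=
    Real.mul_self_sqrt (by linarith)
  have hs0 : 0 ≤ s := Real.sqrt_nonneg _
  set lam := ((q : ℝ) - 1) / 2 + s with hlam
  have hlam0 : 0 ≤ lam := add_nonneg (by linarith) hs0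
  have hll : lam * lam = (q - 1) * lam + q * (n - q) := by
    rw [hlam]; linear_combination hss
  refine lt_of_lt_of_le (by linarith : _ < lam) ?_
  have hcard : (Finset.univ.filter fun i : Fin n => (i : ℕ) < q).card = q := by
    rw [Fin.card_filter_val_lt]; omega
  -- The test vector is the eigenvector of `K_q ∇ (n-q)K_1` for `lam`.
  refine le_graphRho_of_le_sum _ (x := fun i => if (i : ℕ) < q then lam else q) ?_ ?_ ?_
  · intro v
    split_ifs <;> positivity
  · refine ⟨⟨q, by omega⟩, ?_⟩
    simp only [lt_irrefl, if_false]
    positivity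
  · intro v
    by_cases hv : (v : ℕ) < q
    · have hN : (splitGraph n q 1).neighborFinset v = Finset.univ.erase v := by
        ext w
        simp only [SimpleGraph.mem_neighborFinset, splitGraph_one_adj, Finset.mem_erase,
          Finset.mem_univ, and_true, hv, true_or, ne_comm]
      have hsum : ∑ i : Fin n, (if (i : ℕ) < q then lam else (q : ℝ)) = q * lam + (n - q) * q := by
        have hite : ∀ i : Fin n, (if (i : ℕ) < q then lam else (q : ℝ)) =
            q + if (i : ℕ) < q then lam - q else 0 := fun i => by split_ifs <;> ring
        rw [Finset.sum_congr rfl fun i _ => hite i, Finset.sum_add_distrib, ← Finset.sum_filter,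
          Finset.sum_const, Finset.sum_const, hcard, Finset.card_univ, Fintype.card_fin,
          nsmul_eq_mul, nsmul_eq_mul]
        ring
      rw [← Finset.add_sum_erase _ _ (Finset.mem_univ v)] at hsum
      rw [hN]
      simp only [hv, if_true] at hsum ⊢
      linarith
    · simp only [hv, if_false]
      calc lam * q = ∑ w ∈ Finset.univ.filter (fun i : Fin n => (i : ℕ) < q), lam := by
            rw [Finset.sum_const, hcard, nsmul_eq_mul, mul_comm]
        _ = ∑ w ∈ Finset.univ.filter (fun i : Fin n => (i : ℕ) < q),
              (if (w : ℕ) < q then lam else (q : ℝ)) :=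
            Finset.sum_congr rfl fun w hw => (if_pos (Finset.mem_filter.1 hw).2).symm
        _ ≤ _ := by
            refine Finset.sum_le_sum_of_subset_of_nonneg ?_ ?_
            · intro w hw
              have hw' : (w : ℕ) < q := (Finset.mem_filter.1 hw).2
              rw [SimpleGraph.mem_neighborFinset, splitGraph_one_adj]
              refine ⟨fun h => hv (h ▸ hw'), Or.inr (Or.inl hw')⟩
            · intro w _ _
              split_ifs <;> positivity

theorem abs_sqrt_sub_sqrt_le {a b : ℝ} (ha : 0 ≤ a) (hb : 0 < b) :
    |√a - √b| ≤ |a - b| / √b := by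
  have hb' : 0 < √b := Real.sqrt_pos.2 hb
  rw [le_div_iff₀ hb']
  have : a - b = (√a - √b) * (√a + √b) := by
    have h1 := Real.mul_self_sqrt ha
    have h2 := Real.mul_self_sqrt hb.le
    linear_combination -h1 + h2
  rw [this, abs_mul, abs_of_nonneg (add_nonneg (Real.sqrt_nonneg a) hb'.le)]
  exact mul_le_mul_of_nonneg_left (by linarith [Real.sqrt_nonneg a]) (abs_nonneg _)

theorem matrixRho_matrixJ_isBigO {q : ℕ} (δ : ℕ) (hq : 1 ≤ q) :
    (fun n : ℕ => matrixRho (matrixJ n q δ) - (√((q : ℝ) * n) + ((q : ℝ) + δ - 2) / 2))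
      =O[Filter.atTop] (fun n : ℕ => 1 / √(n : ℝ)) := by
  -- The two radicands differ by this quantity, which does not depend on `n`.
  refine Asymptotics.IsBigO.of_bound |((q : ℝ) - δ) ^ 2 / 4 - q ^ 2| ?_
  filter_upwards [Filter.eventually_ge_atTop q] with n hn
  have hq' : (1 : ℝ) ≤ q := by exact_mod_cast hq
  have hn' : (q : ℝ) ≤ n := by exact_mod_cast hn
  have hn0 : (0 : ℝ) < n := by linarith
  rw [matrixRho_matrixJ n q δ hn, Real.norm_eq_abs, Real.norm_eq_abs]
  have h := abs_sqrt_sub_sqrt_le (a := ((q : ℝ) - δ) ^ 2 / 4 + q * (n - q)) (b := q * n)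
    (add_nonneg (by positivity) (mul_nonneg (by positivity) (by linarith))) (by positivity)
  have e1 : ((q : ℝ) - δ) ^ 2 / 4 + q * (n - q) - q * n = ((q : ℝ) - δ) ^ 2 / 4 - q ^ 2 := by ring
  rw [e1] at h
  have e2 : ((q : ℝ) + δ - 2) / 2 + √(((q : ℝ) - δ) ^ 2 / 4 + q * (n - q)) -
      (√((q : ℝ) * n) + ((q : ℝ) + δ - 2) / 2) =
      √(((q : ℝ) - δ) ^ 2 / 4 + q * (n - q)) - √((q : ℝ) * n) := by ring
  rw [e2]
  refine h.trans ?_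
  rw [abs_of_nonneg (by positivity : 0 ≤ 1 / √(n : ℝ)), mul_one_div]
  refine div_le_div_of_nonneg_left (abs_nonneg _) (Real.sqrt_pos.2 hn0) ?_
  exact Real.sqrt_le_sqrt (by nlinarith)

/-- The constant term `(q + δ - 2)/2` is at least 1/2 and absorbs the vanishing error. This disposes
of graphs with spectral radius below `√(qn)`. -/
theorem eventually_sqrt_le_matrixRho_matrixJ {q δ : ℕ} (hq : 1 ≤ q) (hδ : 2 ≤ δ) :
    ∀ᶠ n : ℕ in Filter.atTop, √((q : ℝ) * n) ≤ matrixRho (matrixJ n q δ) := by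
  have ht : Filter.Tendsto (fun n : ℕ => 1 / √(n : ℝ)) Filter.atTop (nhds 0) := by
    simp only [one_div]
    exact (Real.tendsto_sqrt_atTop.comp tendsto_natCast_atTop_atTop).inv_tendsto_atTop
  have h := (matrixRho_matrixJ_isBigO δ hq).trans_tendsto ht
  filter_upwards [h.eventually (lt_mem_nhds (show (-1 / 2 : ℝ) < 0 by norm_num))] with n hn
  have hq' : (1 : ℝ) ≤ q := by exact_mod_cast hq
  have hδ' : (2 : ℝ) ≤ δ := by exact_mod_cast hδ
  linarith

/-! ### Comparison of quadratic forms -/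

/-- If the vertices of `L` carry large weight and all others small weight, and every vertex outside
`L` has fewer than `δ` neighbours among the common neighbours of `L`, then the quadratic form of
the graph is at most that of the join of `K_q` with a graph of maximum degree `δ - 1`. -/
theorem sum_sum_adj_le_of_dominating {W : Type*} [Fintype W] [DecidableEq W] {G : SimpleGraph W}
    [DecidableRel G.Adj] {q δ d : ℕ} {lam c : ℝ} {x : W → ℝ} {L : Finset W}
    (hd : ∀ S : Finset W, S.Nonempty → ∃ v ∈ S, (S.filter (G.Adj v)).card ≤ d)
    (hL : L.card = q) (hq : 1 ≤ q) (hx : ∀ v, 0 ≤ x v) (hxL : ∀ v ∈ L, 1 / 2 ≤ x v)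
    (hxR : ∀ v ∉ L, x v ≤ c) (hc0 : 0 ≤ c) (hc : 2 * ((δ : ℝ) + d) * c ≤ 1)
    (hδ : ∀ v ∉ L,
      ((Finset.univ.filter fun w => ∀ u ∈ L, G.Adj u w).filter (G.Adj v)).card < δ)
    (hlam : (lam - (q - 1)) * (lam - (δ - 1)) = q * (Fintype.card W - q))
    (hlam' : (δ : ℝ) - 1 < lam) :
    ∑ u, ∑ w, (if G.Adj u w then x u * x w else 0) ≤ lam * ∑ u, x u ^ 2 := by
  classical
  set R₀ := Finset.univ.filter fun w => ∀ u ∈ L, G.Adj u w with hR₀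
  set R₁ := Finset.univ.filter fun w => w ∉ L ∧ w ∉ R₀ with hR₁
  have hq' : (0 : ℝ) < q := by exact_mod_cast hq
  have hLR₀ : ∀ w ∈ L, w ∉ R₀ := fun w hw hw' => by
    have := (Finset.mem_filter.1 hw').2 w hw
    exact G.irrefl this
  have mR₁ : ∀ w, w ∈ R₁ ↔ w ∉ L ∧ w ∉ R₀ := fun w => by simp [hR₁]
  -- The majorant: `L` is joined to everything, and outside `L` only the edges inside `R₀` survive.
  set M : W → W → ℝ := fun u w => if u = w then 0 else if u ∈ L ∨ w ∈ L then 1 else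
    if u ∈ R₀ ∧ w ∈ R₀ ∧ G.Adj u w then 1 else 0 with hM
  have hMsymm : ∀ u w, M u w = M w u := fun u w => by
    simp only [hM, eq_comm (a := u), or_comm (a := u ∈ L), G.adj_comm u,
      and_left_comm (a := u ∈ R₀)]
  have hM0 : ∀ u w, 0 ≤ M u w := fun u w => by
    simp only [hM]; split_ifs <;> norm_num
  have hsumy : ∀ a b : ℝ, ∑ w, (if w ∈ L then a else b) = q * a + (Fintype.card W - q) * b := by
    intro a b
    have hite : ∀ w, (if w ∈ L then a else b) = b + if w ∈ L then a - b else 0 := fun w => by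
      split_ifs <;> ring
    rw [Finset.sum_congr rfl fun w _ => hite w, Finset.sum_add_distrib, Finset.sum_ite_mem,
      Finset.univ_inter, Finset.sum_const, Finset.sum_const, hL, Finset.card_univ, nsmul_eq_mul,
      nsmul_eq_mul]
    ring
  have hschur := sum_sum_mul_le_of_mulVec_le (lam := lam) hMsymm hM0
    -- The eigenvector of `J` for `lam`, constant on `L` and on its complement; `hlam` is the
    -- characteristic equation and makes the rows in `L` exact.
    (y := fun w => if w ∈ L then lam - (δ - 1) else (q : ℝ))
    (fun w => by split_ifs <;> linarith) (fun u => by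
      by_cases hu : u ∈ L
      · have h1 : ∀ w, M u w * (if w ∈ L then lam - (δ - 1) else (q : ℝ)) =
            (if w ∈ L then lam - (δ - 1) else (q : ℝ)) -
              if u = w then lam - (δ - 1) else 0 := fun w => by
          by_cases h : u = w
          · subst h
            simp [hM, hu]
          · simp [hM, hu, h]
        rw [Finset.sum_congr rfl fun w _ => h1 w, Finset.sum_sub_distrib, hsumy,
          Finset.sum_ite_eq, if_pos (Finset.mem_univ u), if_pos hu]
        linarith
      · have h1 : ∀ w, M u w * (if w ∈ L then lam - (δ - 1) else (q : ℝ)) ≤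
            (if w ∈ L then lam - (δ - 1) else 0) +
              if w ∈ R₀.filter (G.Adj u) then (q : ℝ) else 0 := fun w => by
          by_cases hw : w ∈ L
          · have huw : u ≠ w := fun h => hu (h ▸ hw)
            simp [hM, hw, huw, hLR₀ w hw]
          · by_cases huw : u = w
            · simp only [hM, huw, if_true, zero_mul, hw, if_false, zero_add]
              split_ifs <;> linarith
            · simp only [hM, huw, hu, hw, if_false, or_self, zero_add, Finset.mem_filter]
              by_cases h : w ∈ R₀ ∧ G.Adj u w
              · simp only [h, and_self, if_true, and_true]
                split_ifs <;> linarith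
              · simp [h]
        have h2 : ((R₀.filter (G.Adj u)).card : ℝ) ≤ δ - 1 := by
          have : (R₀.filter (G.Adj u)).card + 1 ≤ δ := hδ u hu
          have : ((R₀.filter (G.Adj u)).card : ℝ) + 1 ≤ δ := by exact_mod_cast this
          linarith
        refine (Finset.sum_le_sum fun w _ => h1 w).trans ?_
        rw [Finset.sum_add_distrib, hsumy, Finset.sum_ite_mem, Finset.univ_inter, Finset.sum_const,
          nsmul_eq_mul, if_neg hu]
        nlinarith) x
  -- comparison of the two quadratic forms
  have hentry : ∀ u w, (if G.Adj u w then x u * x w else 0) +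
      ((if u ∈ R₁ ∧ w ∈ L ∧ ¬ G.Adj u w then x u * x w else 0) +
        (if w ∈ R₁ ∧ u ∈ L ∧ ¬ G.Adj w u then x w * x u else 0)) ≤ M u w * (x u * x w) +
      ((if u ∈ R₁ ∧ w ∈ R₀ ∧ G.Adj u w then x u * x w else 0) +
        (if w ∈ R₁ ∧ u ∈ R₀ ∧ G.Adj w u then x w * x u else 0) +
        (if u ∈ R₁ ∧ w ∈ R₁ then (if G.Adj u w then x u * x w else 0) else 0)) := by
    intro u w
    have hxx : 0 ≤ x u * x w := mul_nonneg (hx u) (hx w)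
    rw [mul_comm (x w) (x u)]
    simp only [G.adj_comm w u]
    simp only [mR₁, hM]
    by_cases huw : u = w
    · subst huw
      by_cases b1 : u ∈ L <;> simp [b1]
    · by_cases b1 : u ∈ L <;> by_cases b2 : w ∈ L <;> by_cases b3 : u ∈ R₀ <;>
        by_cases b4 : w ∈ R₀ <;> by_cases b5 : G.Adj u w <;>
        simp [huw, b1, b2, b3, b4, b5, hxx]
  have hsum := Finset.sum_le_sum fun u (_ : u ∈ Finset.univ) =>
    Finset.sum_le_sum fun w (_ : w ∈ Finset.univ) => hentry u w
  simp only [Finset.sum_add_distrib] at hsum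
  rw [Finset.sum_comm (f := fun u w => if w ∈ R₁ ∧ u ∈ L ∧ ¬ G.Adj w u then x w * x u else 0),
    Finset.sum_comm (f := fun u w => if w ∈ R₁ ∧ u ∈ R₀ ∧ G.Adj w u then x w * x u else 0)] at hsum
  have hE : 1 / 2 * ∑ u ∈ R₁, x u ≤
      ∑ u, ∑ w, (if u ∈ R₁ ∧ w ∈ L ∧ ¬ G.Adj u w then x u * x w else 0) := by
    have hnn : ∀ u w, 0 ≤ (if u ∈ R₁ ∧ w ∈ L ∧ ¬ G.Adj u w then x u * x w else 0) := fun u w => by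
      split_ifs
      · exact mul_nonneg (hx u) (hx w)
      · rfl
    rw [Finset.mul_sum]
    refine (Finset.sum_le_sum fun u hu => ?_).trans
      (Finset.sum_le_sum_of_subset_of_nonneg (Finset.subset_univ R₁)
        fun u _ _ => Finset.sum_nonneg fun w _ => hnn u w)
    have : ∃ w ∈ L, ¬ G.Adj w u := by
      by_contra! h
      exact ((mR₁ u).1 hu).2 (by simpa [hR₀] using h)
    obtain ⟨w, hw, hwu⟩ := this
    refine le_trans ?_ (Finset.single_le_sum (fun w _ => hnn u w) (Finset.mem_univ w))
    rw [if_pos ⟨hu, hw, fun h => hwu h.symm⟩, mul_comm]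
    exact mul_le_mul_of_nonneg_left (hxL w hw) (hx u)
  have hT : ∑ u, ∑ w, (if u ∈ R₁ ∧ w ∈ R₀ ∧ G.Adj u w then x u * x w else 0) ≤
      δ * c * ∑ u ∈ R₁, x u := by
    have h1 : ∀ u, ∑ w, (if u ∈ R₁ ∧ w ∈ R₀ ∧ G.Adj u w then x u * x w else 0) ≤
        if u ∈ R₁ then δ * c * x u else 0 := by
      intro u
      by_cases hu : u ∈ R₁
      · simp only [hu, true_and, if_true]
        rw [← Finset.sum_filter]
        have hcard : ((R₀.filter (G.Adj u)).card : ℝ) ≤ δ := by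
          exact_mod_cast (hδ u ((mR₁ u).1 hu).1).le
        have hset : Finset.univ.filter (fun w => w ∈ R₀ ∧ G.Adj u w) = R₀.filter (G.Adj u) := by
          ext w; simp
        rw [hset]
        calc ∑ w ∈ R₀.filter (G.Adj u), x u * x w ≤ ∑ w ∈ R₀.filter (G.Adj u), x u * c := by
              refine Finset.sum_le_sum fun w hw => ?_
              exact mul_le_mul_of_nonneg_left
                (hxR w fun h => hLR₀ w h (Finset.mem_filter.1 hw).1) (hx u)
          _ = (R₀.filter (G.Adj u)).card * (x u * c) := by
              rw [Finset.sum_const, nsmul_eq_mul]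
          _ ≤ δ * (x u * c) := mul_le_mul_of_nonneg_right hcard (mul_nonneg (hx u) hc0)
          _ = δ * c * x u := by ring
      · simp [hu]
    refine (Finset.sum_le_sum fun u _ => h1 u).trans ?_
    rw [Finset.sum_ite_mem, Finset.univ_inter, Finset.mul_sum]
  have hT' : ∑ u, ∑ w, (if u ∈ R₁ ∧ w ∈ R₁ then (if G.Adj u w then x u * x w else 0) else 0) ≤
      2 * d * c * ∑ u ∈ R₁, x u := by
    refine le_trans (le_of_eq ?_) (sum_sum_adj_le_of_degenerate hd R₁ (fun v _ => hx v)
      (fun v hv => hxR v ((mR₁ v).1 hv).1))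
    simp only [ite_and, Finset.sum_ite_irrel, Finset.sum_const_zero, Finset.sum_ite_mem,
      Finset.univ_inter]
  have hR₁0 : 0 ≤ ∑ u ∈ R₁, x u := Finset.sum_nonneg fun u _ => hx u
  -- The added pairs contribute at least `∑ u ∈ R₁, x u` in total, the deleted ones at most `2(δ +
  -- d)c` times that sum, and `hc` makes this factor at most 1.
  nlinarith

/-! ### Weights of the Perron vector: few heavy vertices -/

section

variable {W : Type*} [Fintype W] {G : SimpleGraph W} [DecidableRel G.Adj] {d : ℕ}

theorem sum_degree_le_of_degenerate
    (hd : ∀ S : Finset W, S.Nonempty → ∃ v ∈ S, (S.filter (G.Adj v)).card ≤ d) :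
    ∑ u, (G.degree u : ℝ) ≤ 2 * d * Fintype.card W := by
  have h := sum_card_filter_adj_le_of_degenerate hd Finset.univ
  rw [Finset.card_univ] at h
  refine le_trans (le_of_eq (Finset.sum_congr rfl fun u _ => ?_)) h
  rw [← G.card_neighborFinset_eq_degree, G.neighborFinset_eq_filter]

/-- The two-step eigenvalue equation, in which the vertices of weight at most `t` contribute at
most `2dtn`. -/
theorem sq_mul_le_add_sum_heavy
    (hd : ∀ S : Finset W, S.Nonempty → ∃ v ∈ S, (S.filter (G.Adj v)).card ≤ d)
    {x : W → ℝ} {ρ t : ℝ} (ht : 0 ≤ t)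
    (heig : ∀ v, ρ * x v = ∑ w ∈ G.neighborFinset v, x w) (v : W) :
    ρ ^ 2 * x v ≤ 2 * d * t * Fintype.card W + ∑ u ∈ G.neighborFinset v,
      ∑ w ∈ (Finset.univ.filter fun w => t < x w).filter (G.Adj u), x w := by
  have h1 : ρ ^ 2 * x v = ∑ u ∈ G.neighborFinset v, ∑ w ∈ G.neighborFinset u, x w := by
    rw [pow_two, mul_assoc, heig v, Finset.mul_sum]
    exact Finset.sum_congr rfl fun u _ => heig u
  have h2 : ∀ u, ∑ w ∈ G.neighborFinset u, x w ≤ t * G.degree u +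
      ∑ w ∈ (Finset.univ.filter fun w => t < x w).filter (G.Adj u), x w := by
    intro u
    rw [← Finset.sum_filter_add_sum_filter_not (G.neighborFinset u) (fun w => t < x w), add_comm]
    refine add_le_add ?_ (le_of_eq ?_)
    · calc _ ≤ ∑ w ∈ (G.neighborFinset u).filter (fun w => ¬ t < x w), t :=
            Finset.sum_le_sum fun w hw => not_lt.1 (Finset.mem_filter.1 hw).2
        _ = ((G.neighborFinset u).filter (fun w => ¬ t < x w)).card * t := by
            rw [Finset.sum_const, nsmul_eq_mul]
        _ ≤ G.degree u * t := by
            refine mul_le_mul_of_nonneg_right ?_ ht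
            rw [← G.card_neighborFinset_eq_degree]
            exact_mod_cast Finset.card_filter_le _ _
        _ = t * G.degree u := mul_comm _ _
    · refine Finset.sum_congr ?_ fun _ _ => rfl
      ext w
      simp [and_comm]
  have h3 : ∑ u ∈ G.neighborFinset v, t * (G.degree u : ℝ) ≤ 2 * d * t * Fintype.card W := by
    calc _ ≤ ∑ u, t * (G.degree u : ℝ) :=
          Finset.sum_le_sum_of_subset_of_nonneg (Finset.subset_univ _)
            fun u _ _ => by positivity
      _ = t * ∑ u, (G.degree u : ℝ) := by rw [Finset.mul_sum]
      _ ≤ t * (2 * d * Fintype.card W) :=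
          mul_le_mul_of_nonneg_left (sum_degree_le_of_degenerate hd) ht
      _ = _ := by ring
  rw [h1]
  refine (Finset.sum_le_sum fun u _ => h2 u).trans ?_
  rw [Finset.sum_add_distrib]
  linarith

theorem card_mul_le_of_le_degree
    (hd : ∀ S : Finset W, S.Nonempty → ∃ v ∈ S, (S.filter (G.Adj v)).card ≤ d)
    {S : Finset W} {D : ℝ} (hS : ∀ v ∈ S, D ≤ G.degree v) :
    S.card * D ≤ 2 * d * Fintype.card W := by
  calc S.card * D = ∑ v ∈ S, D := by rw [Finset.sum_const, nsmul_eq_mul]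
    _ ≤ ∑ v ∈ S, (G.degree v : ℝ) := Finset.sum_le_sum hS
    _ ≤ ∑ v, (G.degree v : ℝ) :=
        Finset.sum_le_sum_of_subset_of_nonneg (Finset.subset_univ _) fun u _ _ => by positivity
    _ ≤ _ := sum_degree_le_of_degenerate hd

/-- In a degenerate graph on `n` vertices whose spectral radius is at least `√n`, the number of
vertices of eigenvector weight more than `η` is bounded independently of `n`. -/
theorem card_heavy_mul_le
    (hd : ∀ S : Finset W, S.Nonempty → ∃ v ∈ S, (S.filter (G.Adj v)).card ≤ d) (hd1 : 1 ≤ d)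
    {x : W → ℝ} {ρ η : ℝ} (hη : 0 < η) (hx1 : ∀ v, x v ≤ 1)
    (heig : ∀ v, ρ * x v = ∑ w ∈ G.neighborFinset v, x w)
    (hρ : √(Fintype.card W : ℝ) ≤ ρ) (hn : 64 * (d : ℝ) ^ 3 ≤ η ^ 2 * √(Fintype.card W : ℝ)) :
    ((Finset.univ.filter fun w => η < x w).card : ℝ) * η ≤ 16 * d ^ 2 := by
  classical
  have hd' : (1 : ℝ) ≤ d := by exact_mod_cast hd1
  have hd0 : (0 : ℝ) < d := by linarith
  set n : ℝ := ((Fintype.card W : ℕ) : ℝ) with hndef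
  set r := √n with hr
  have hrr : r * r = n := Real.mul_self_sqrt (by positivity)
  have hr0 : 0 < r := by
    by_contra h
    have : r = 0 := le_antisymm (not_lt.1 h) (Real.sqrt_nonneg _)
    rw [this, mul_zero] at hn
    have : 0 < 64 * (d : ℝ) ^ 3 := by positivity
    linarith
  have hn0 : 0 < n := by rw [← hrr]; positivity
  have hρ0 : 0 < ρ := hr0.trans_le hρ
  have hρn : n ≤ ρ ^ 2 := by rw [← hrr, pow_two]; exact mul_self_le_mul_self hr0.le hρ
  -- Chosen so that the light vertices contribute `2dtn = ηn/2`, half of the available `ηn`.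
  set t := η / (4 * d) with ht
  have ht0 : 0 < t := by positivity
  have htd : 4 * d * t = η := by rw [ht]; field_simp
  have hdegx : ∀ v, ρ * x v ≤ G.degree v := fun v => by
    rw [heig v, ← G.card_neighborFinset_eq_degree]
    calc _ ≤ ∑ w ∈ G.neighborFinset v, (1 : ℝ) := Finset.sum_le_sum fun w _ => hx1 w
      _ = _ := by simp
  set T := Finset.univ.filter fun w => t < x w with hT
  have hTc : T.card * (r * t) ≤ 2 * d * n := by
    refine card_mul_le_of_le_degree hd fun v hv => ?_
    have hv' : t < x v := (Finset.mem_filter.1 hv).2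
    refine le_trans ?_ (hdegx v)
    exact mul_le_mul hρ hv'.le ht0.le hρ0.le
  have hTc' : T.card * t ≤ 2 * d * r := by
    have : (T.card * t) * r ≤ (2 * d * r) * r := by
      calc (T.card * t) * r = T.card * (r * t) := by ring
        _ ≤ 2 * d * n := hTc
        _ = _ := by rw [← hrr]; ring
    exact le_of_mul_le_mul_right this hr0
  -- Vertices of `T` have degree at least `t√n`, so `|T|` is `O(√n)`, negligible against `n` by
  -- `hn`. The remaining quarter of `ηn` forces linear degree in `hdeg`.
  have hTd : 2 * d * T.card ≤ n * η / 4 := by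
    have h1 : 2 * d * T.card * η ≤ n * η / 4 * η := by
      calc 2 * d * T.card * η = 8 * d ^ 2 * (T.card * t) := by rw [← htd]; ring
        _ ≤ 8 * d ^ 2 * (2 * d * r) := mul_le_mul_of_nonneg_left hTc' (by positivity)
        _ = 64 * (d : ℝ) ^ 3 * r / 4 := by ring
        _ ≤ η ^ 2 * r * r / 4 := by
            have := mul_le_mul_of_nonneg_right hn hr0.le
            linarith
        _ = n * η / 4 * η := by rw [← hrr]; ring
    exact le_of_mul_le_mul_right h1 hη
  have hdeg : ∀ v ∈ Finset.univ.filter (fun w => η < x w), n * η / (8 * d) ≤ G.degree v := by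
    intro v hv
    have hv' : η < x v := (Finset.mem_filter.1 hv).2
    have h1 := sq_mul_le_add_sum_heavy hd ht0.le heig v
    have h2 : ∑ u ∈ G.neighborFinset v, ∑ w ∈ T.filter (G.Adj u), x w ≤
        2 * d * (G.degree v + T.card) := by
      calc _ ≤ ∑ u ∈ G.neighborFinset v, ((T.filter (G.Adj u)).card : ℝ) := by
            refine Finset.sum_le_sum fun u _ => ?_
            calc _ ≤ ∑ w ∈ T.filter (G.Adj u), (1 : ℝ) := Finset.sum_le_sum fun w _ => hx1 w
              _ = _ := by simp
        _ ≤ ∑ u ∈ G.neighborFinset v ∪ T,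
              (((G.neighborFinset v ∪ T).filter (G.Adj u)).card : ℝ) := by
            refine (Finset.sum_le_sum fun u _ => ?_).trans
              (Finset.sum_le_sum_of_subset_of_nonneg Finset.subset_union_left
                fun u _ _ => by positivity)
            exact_mod_cast Finset.card_le_card
              (Finset.filter_subset_filter _ Finset.subset_union_right)
        _ ≤ 2 * d * (G.neighborFinset v ∪ T).card := sum_card_filter_adj_le_of_degenerate hd _
        _ ≤ _ := by
            refine mul_le_mul_of_nonneg_left ?_ (by positivity)
            rw [← G.card_neighborFinset_eq_degree]
            exact_mod_cast Finset.card_union_le _ _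
    have h3 : n * η ≤ ρ ^ 2 * x v := mul_le_mul hρn hv'.le hη.le (by positivity)
    rw [div_le_iff₀ (by positivity)]
    have h4 : 2 * d * t * n = n * η / 2 := by rw [← htd]; ring
    rw [h4] at h1
    linarith
  have h5 := card_mul_le_of_le_degree hd hdeg
  have h6 : ((Finset.univ.filter fun w => η < x w).card : ℝ) * η * n ≤ 16 * d ^ 2 * n := by
    have h7 := mul_le_mul_of_nonneg_right h5 (by positivity : (0 : ℝ) ≤ 8 * d)
    calc _ = ((Finset.univ.filter fun w => η < x w).card : ℝ) * (n * η / (8 * d)) * (8 * d) := by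
          field_simp
      _ ≤ _ := h7
      _ = _ := by ring
  exact le_of_mul_le_mul_right h6 hn0

end

/-! ### Extracting the `q` dominating vertices -/

section

variable {W : Type*} [Fintype W] [DecidableEq W] {G : SimpleGraph W} [DecidableRel G.Adj]
  {d q δ : ℕ}

/-- Only boundedly many vertices have more than `q` neighbours in a given bounded set, if any
`q + 1` vertices have few common neighbours. -/
theorem card_filter_lt_card_filter_le
    (hforb : ∀ (L R : Finset W) (v : W), L.card = q → (∀ u ∈ L, ∀ w ∈ R, G.Adj u w) → v ∉ L →
      d ≤ R.card → (R.filter (G.Adj v)).card < δ) (hδ : δ ≤ d) (L : Finset W) :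
    (Finset.univ.filter fun u => q < (L.filter (G.Adj u)).card).card ≤ 2 ^ L.card * d := by
  have hcommon : ∀ T ∈ L.powersetCard (q + 1),
      (Finset.univ.filter fun u => ∀ t ∈ T, G.Adj t u).card ≤ d := by
    intro T hT
    by_contra! h
    have hTc := (Finset.mem_powersetCard.1 hT).2
    obtain ⟨v, hv⟩ : T.Nonempty := Finset.card_pos.1 (by omega)
    -- One of the `q + 1` vertices plays the further vertex: it is adjacent to all the common
    -- neighbours, more than `d ≥ δ` of them.
    have h1 := hforb (T.erase v) (Finset.univ.filter fun u => ∀ t ∈ T, G.Adj t u) v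
      (by rw [Finset.card_erase_of_mem hv]; omega)
      (fun u hu w hw => (Finset.mem_filter.1 hw).2 u (Finset.mem_of_mem_erase hu))
      (Finset.notMem_erase v T) h.le
    have hmem : ∀ w ∈ Finset.univ.filter fun u => ∀ t ∈ T, G.Adj t u, G.Adj v w :=
      fun w hw => (Finset.mem_filter.1 hw).2 v hv
    rw [Finset.filter_true_of_mem hmem] at h1
    omega
  calc _ ≤ ((L.powersetCard (q + 1)).biUnion fun T =>
        Finset.univ.filter fun u => ∀ t ∈ T, G.Adj t u).card := by
        refine Finset.card_le_card fun u hu => ?_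
        have hu' : q < (L.filter (G.Adj u)).card := (Finset.mem_filter.1 hu).2
        obtain ⟨T, hTs, hTc⟩ := Finset.exists_subset_card_eq (Nat.succ_le_of_lt hu')
        refine Finset.mem_biUnion.2 ⟨T, Finset.mem_powersetCard.2
          ⟨hTs.trans (Finset.filter_subset _ _), hTc⟩, ?_⟩
        simp only [Finset.mem_filter, Finset.mem_univ, true_and]
        exact fun t ht => (Finset.mem_filter.1 (hTs ht)).2.symm
    _ ≤ (L.powersetCard (q + 1)).card * d := Finset.card_biUnion_le_card_mul _ _ _ hcommon
    _ ≤ 2 ^ L.card * d := by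
        refine Nat.mul_le_mul_right _ ?_
        rw [← Finset.card_powerset]
        exact Finset.card_le_card fun T hT =>
          Finset.mem_powerset.2 (Finset.mem_powersetCard.1 hT).1

/-- Structure of the graphs with spectral radius at least `√(qn)`: there are `q` vertices of large
eigenvector weight with many common neighbours, and all other vertices have small weight. -/
theorem exists_dominating_set
    (hd : ∀ S : Finset W, S.Nonempty → ∃ v ∈ S, (S.filter (G.Adj v)).card ≤ d)
    (hforb : ∀ (L R : Finset W) (v : W), L.card = q → (∀ u ∈ L, ∀ w ∈ R, G.Adj u w) → v ∉ L →
      d ≤ R.card → (R.filter (G.Adj v)).card < δ)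
    (hδ : δ ≤ d) (hq : 1 ≤ q) (hqd : q ≤ d)
    {x : W → ℝ} {ρ η : ℝ} (hη : 0 < η) (hηd : η * (44 * (d : ℝ) ^ 3) = 1)
    (hx0 : ∀ v, 0 ≤ x v) (hx1 : ∀ v, x v ≤ 1) {z : W} (hz : x z = 1)
    (heig : ∀ v, ρ * x v = ∑ w ∈ G.neighborFinset v, x w)
    (hρ : √((q : ℝ) * Fintype.card W) ≤ ρ) {C : ℕ}
    (hC : (Finset.univ.filter fun w => η < x w).card ≤ C)
    (hn : (2 : ℝ) ^ C * C ≤ η * Fintype.card W) :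
    ∃ L : Finset W, L.card = q ∧ (∀ v ∈ L, 1 / 2 ≤ x v) ∧ (∀ v ∉ L, x v ≤ 11 * d ^ 2 * η) ∧
      d ≤ (Finset.univ.filter fun w => ∀ u ∈ L, G.Adj u w).card := by
  have hq' : (1 : ℝ) ≤ q := by exact_mod_cast hq
  have hqd' : (q : ℝ) ≤ d := by exact_mod_cast hqd
  have hδ' : (δ : ℝ) ≤ d := by exact_mod_cast hδ
  have hd' : (1 : ℝ) ≤ d := hq'.trans hqd'
  have hd2 : (d : ℝ) ≤ d ^ 2 := by nlinarith
  have hηd2 : 44 * (d ^ 2 * η) ≤ 1 := by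
    have : 44 * (d ^ 2 * η) * 1 ≤ 44 * (d ^ 2 * η) * d :=
      mul_le_mul_of_nonneg_left hd' (by positivity)
    nlinarith
  have hηd1 : d * η ≤ d ^ 2 * η := mul_le_mul_of_nonneg_right hd2 hη.le
  have hη1 : η ≤ d * η := by nlinarith
  set n : ℝ := ((Fintype.card W : ℕ) : ℝ) with hndef
  set L₁ := Finset.univ.filter fun w => η < x w with hL₁
  have hC1 : 1 ≤ C := by
    refine le_trans (Finset.card_pos.2 ⟨z, ?_⟩) hC
    simp only [hL₁, Finset.mem_filter, Finset.mem_univ, true_and, hz]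
    linarith
  have hηn : 1 ≤ η * n := by
    refine le_trans ?_ hn
    exact_mod_cast one_le_mul (Nat.one_le_two_pow) hC1
  have hn0 : 0 < n := pos_of_mul_pos_right (by linarith : 0 < η * n) hη.le
  have hρ2 : q * n ≤ ρ ^ 2 := by
    have h1 := Real.mul_self_sqrt (show 0 ≤ (q : ℝ) * n by positivity)
    rw [← h1, pow_two]
    exact mul_self_le_mul_self (Real.sqrt_nonneg _) hρ
  set X := Finset.univ.filter fun u => q < (L₁.filter (G.Adj u)).card with hX
  have hXc : (X.card : ℝ) * C ≤ d * (η * n) := by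
    have h1 : X.card ≤ 2 ^ C * d := (card_filter_lt_card_filter_le hforb hδ L₁).trans
      (Nat.mul_le_mul_right _ (Nat.pow_le_pow_right (by norm_num) hC))
    have h2 : (X.card : ℝ) ≤ 2 ^ C * d := by exact_mod_cast h1
    calc (X.card : ℝ) * C ≤ 2 ^ C * d * C := mul_le_mul_of_nonneg_right h2 (by positivity)
      _ = d * (2 ^ C * C) := by ring
      _ ≤ _ := mul_le_mul_of_nonneg_left hn (by positivity)
  set f : W → ℝ := fun u => ∑ w ∈ L₁.filter (G.Adj u), x w with hf
  have hf1 : ∀ u, f u ≤ (L₁.filter (G.Adj u)).card := fun u => by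
    calc f u ≤ ∑ w ∈ L₁.filter (G.Adj u), (1 : ℝ) := Finset.sum_le_sum fun w _ => hx1 w
      _ = _ := by simp
  have hfC : ∀ u, f u ≤ C := fun u => (hf1 u).trans (by
    exact_mod_cast (Finset.card_filter_le _ _).trans hC)
  have hXq : ∀ u ∉ X, (L₁.filter (G.Adj u)).card ≤ q := fun u hu => by
    simpa [hX] using hu
  have hfq : ∀ u ∉ X, f u ≤ q := fun u hu => (hf1 u).trans (by exact_mod_cast hXq u hu)
  -- Of the error `3dηn`, light vertices account for `2dηn` and the bounded set `X` for `dηn`.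
  have hmain : ∀ v, q * n * x v ≤ 3 * (d * η) * n + ∑ u ∈ G.neighborFinset v \ X, f u := by
    intro v
    have h1 := sq_mul_le_add_sum_heavy hd hη.le heig v
    have h2 : ∑ u ∈ G.neighborFinset v, f u ≤
        ∑ u ∈ G.neighborFinset v \ X, f u + d * (η * n) := by
      rw [← Finset.sum_inter_add_sum_sdiff (G.neighborFinset v) X, add_comm]
      refine add_le_add le_rfl (le_trans ?_ hXc)
      calc _ ≤ ∑ u ∈ G.neighborFinset v ∩ X, (C : ℝ) := Finset.sum_le_sum fun u _ => hfC u
        _ = (G.neighborFinset v ∩ X).card * (C : ℝ) := by rw [Finset.sum_const, nsmul_eq_mul]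
        _ ≤ X.card * C := by
            refine mul_le_mul_of_nonneg_right ?_ (by positivity)
            exact_mod_cast Finset.card_le_card Finset.inter_subset_right
    have h3 : q * n * x v ≤ ρ ^ 2 * x v := mul_le_mul_of_nonneg_right hρ2 (hx0 v)
    linarith
  have hdeg : ∀ v, q * n * x v ≤ 3 * (d * η) * n + q * G.degree v := by
    intro v
    refine (hmain v).trans (add_le_add le_rfl ?_)
    calc _ ≤ ∑ u ∈ G.neighborFinset v \ X, (q : ℝ) :=
          Finset.sum_le_sum fun u hu => hfq u (Finset.mem_sdiff.1 hu).2
      _ = (G.neighborFinset v \ X).card * (q : ℝ) := by rw [Finset.sum_const, nsmul_eq_mul]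
      _ ≤ G.degree v * q := by
          refine mul_le_mul_of_nonneg_right ?_ (by positivity)
          rw [← G.card_neighborFinset_eq_degree]
          exact_mod_cast Finset.card_le_card Finset.sdiff_subset
      _ = _ := mul_comm _ _
  -- Averaging at the vertex `z` of weight 1: some `u` sees heavy weight almost `q`. Having at most
  -- `q` heavy neighbours, it has exactly `q`, all of weight near 1.
  obtain ⟨u, huX, hu⟩ : ∃ u ∉ X, q - 4 * (d * η) < f u := by
    by_contra! h
    have h1 := hmain z
    have h2 : ∑ u ∈ G.neighborFinset z \ X, f u ≤ n * (q - 4 * (d * η)) := by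
      calc _ ≤ ∑ u ∈ G.neighborFinset z \ X, ((q : ℝ) - 4 * (d * η)) :=
            Finset.sum_le_sum fun u hu => h u (Finset.mem_sdiff.1 hu).2
        _ = (G.neighborFinset z \ X).card * ((q : ℝ) - 4 * (d * η)) := by
            rw [Finset.sum_const, nsmul_eq_mul]
        _ ≤ _ := by
            refine mul_le_mul_of_nonneg_right ?_ (by linarith)
            exact Nat.cast_le.2 (Finset.card_le_univ _)
    rw [hz, mul_one] at h1
    have : 0 < d * η * n := by positivity
    linarith
  set L := L₁.filter (G.Adj u) with hL
  have hLc : L.card = q := by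
    refine le_antisymm (hXq u huX) ?_
    have h1 : (q : ℝ) < L.card + 1 := by linarith [hf1 u]
    exact Nat.lt_succ_iff.1 (by exact_mod_cast h1)
  have hxL : ∀ w ∈ L, 1 - 4 * (d * η) ≤ x w := by
    intro w hw
    have h1 : ∑ w ∈ L.erase w, x w ≤ q - 1 := by
      calc _ ≤ ∑ w ∈ L.erase w, (1 : ℝ) := Finset.sum_le_sum fun w _ => hx1 w
        _ = (L.erase w).card := by simp
        _ = q - 1 := by
            rw [Finset.card_erase_of_mem hw, hLc, Nat.cast_sub hq, Nat.cast_one]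
    have h2 : f u = x w + ∑ w ∈ L.erase w, x w := (Finset.add_sum_erase L x hw).symm
    linarith
  have hdegL : ∀ w ∈ L, n - G.degree w ≤ 7 * (d * η) * n := by
    intro w hw
    have h1 := hdeg w
    have h2 : q * n * (1 - 4 * (d * η)) ≤ q * n * x w :=
      mul_le_mul_of_nonneg_left (hxL w hw) (by positivity)
    have h3 : 3 * (d * η) * n ≤ q * (3 * (d * η) * n) :=
      le_mul_of_one_le_left (by positivity) hq'
    have h4 : q * (n - G.degree w) ≤ q * (7 * (d * η) * n) := by linarith
    exact le_of_mul_le_mul_left h4 (by linarith)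
  set R := Finset.univ.filter fun w => ∀ u ∈ L, G.Adj u w with hR
  have hRc : ((Rᶜ).card : ℝ) ≤ 7 * (d ^ 2 * η) * n := by
    have hsub : Rᶜ ⊆ L.biUnion fun w => (G.neighborFinset w)ᶜ := by
      intro v hv
      simp only [hR, Finset.mem_compl, Finset.mem_filter, Finset.mem_univ, true_and, not_forall] at hv
      obtain ⟨w, hw, hwv⟩ := hv
      exact Finset.mem_biUnion.2 ⟨w, hw, by simpa using hwv⟩
    have h1 : ((Rᶜ).card : ℝ) ≤ ∑ w ∈ L, (((G.neighborFinset w)ᶜ).card : ℝ) := by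
      exact_mod_cast (Finset.card_le_card hsub).trans Finset.card_biUnion_le
    calc ((Rᶜ).card : ℝ) ≤ _ := h1
      _ ≤ ∑ w ∈ L, 7 * (d * η) * n := by
          refine Finset.sum_le_sum fun w hw => le_trans (le_of_eq ?_) (hdegL w hw)
          rw [Finset.card_compl, Nat.cast_sub (Finset.card_le_univ _),
            G.card_neighborFinset_eq_degree]
      _ = q * (7 * (d * η) * n) := by rw [Finset.sum_const, nsmul_eq_mul, hLc]
      _ ≤ d * (7 * (d * η) * n) := mul_le_mul_of_nonneg_right hqd' (by positivity)
      _ = _ := by ring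
  have hdη : (d : ℝ) ≤ d ^ 2 * η * n := by
    calc (d : ℝ) ≤ d ^ 2 := hd2
      _ ≤ d ^ 2 * (η * n) := le_mul_of_one_le_right (by positivity) hηn
      _ = _ := by ring
  have hηn' : 44 * (d ^ 2 * η * n) ≤ n := by
    have := mul_le_mul_of_nonneg_right hηd2 hn0.le
    linarith
  have hRd : d ≤ R.card := by
    have h1 : ((Rᶜ).card : ℝ) = n - R.card := by
      rw [Finset.card_compl, Nat.cast_sub (Finset.card_le_univ _)]
    have h2 : (d : ℝ) ≤ R.card := by linarith
    exact_mod_cast h2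
  refine ⟨L, hLc, fun w hw => by linarith [hxL w hw], fun v hv => ?_, hRd⟩
  have h1 : (R.filter (G.Adj v)).card < δ :=
    hforb L R v hLc (fun u hu w hw => (Finset.mem_filter.1 hw).2 u hu) hv hRd
  -- Fewer than `δ` neighbours in `R` and at most `7d²ηn` outside it; `hdeg` turns this small degree
  -- into small weight, `3 + 8 = 11`.
  have h2 : (G.degree v : ℝ) ≤ 8 * (d ^ 2 * η) * n := by
    have h3 : G.degree v ≤ (R.filter (G.Adj v)).card + (Rᶜ).card := by
      rw [← G.card_neighborFinset_eq_degree]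
      refine (Finset.card_le_card fun w hw => ?_).trans (Finset.card_union_le _ _)
      by_cases h : w ∈ R
      · exact Finset.mem_union_left _ (Finset.mem_filter.2 ⟨h, by simpa using hw⟩)
      · exact Finset.mem_union_right _ (Finset.mem_compl.2 h)
    have h4 : (G.degree v : ℝ) ≤ δ + (Rᶜ).card := by
      exact_mod_cast h3.trans (Nat.add_le_add_right h1.le _)
    linarith
  have h3 := hdeg v
  have h4 : 3 * (d * η) * n ≤ q * (3 * (d ^ 2 * η) * n) := by
    have h5 : 3 * (d * η) * n ≤ 3 * (d ^ 2 * η) * n :=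
      mul_le_mul_of_nonneg_right (by linarith) hn0.le
    exact h5.trans (le_mul_of_one_le_left (by positivity) hq')
  have h5 : q * (G.degree v : ℝ) ≤ q * (8 * (d ^ 2 * η) * n) :=
    mul_le_mul_of_nonneg_left h2 (by positivity)
  have h6 : (q * n) * x v ≤ (q * n) * (11 * d ^ 2 * η) := by linarith
  exact le_of_mul_le_mul_left h6 (by positivity)

end

/-! ### Upper bound and conclusion -/

/-- The spectral radius of an `F`-free graph on sufficiently many vertices is at most `ρ(J)`. -/
theorem eventually_graphRho_le_matrixRho_matrixJ {V : Type*} [Fintype V] {F : SimpleGraph V}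
    [DecidableRel F.Adj] (hF : F.IsTree) {A B : Finset V}
    (hAB : F.IsBipartiteWith (A : Set V) (B : Set V)) (hcover : ∀ v, v ∈ A ∨ v ∈ B) {q δ : ℕ}
    (hq : A.card = q + 1) {a₀ : V} (ha₀ : a₀ ∈ A) (hδ : F.degree a₀ = δ) (hq1 : 1 ≤ q)
    (hδ2 : 2 ≤ δ) :
    ∀ᶠ n : ℕ in Filter.atTop, ∀ G : SimpleGraph (Fin n), F.Free G →
      graphRho G ≤ matrixRho (matrixJ n q δ) := by
  classical
  set d := Fintype.card V with hd
  have hqd : q ≤ d := by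
    have := Finset.card_le_univ A
    omega
  have hδd : δ ≤ d := hδ ▸ (F.degree_lt_card_verts a₀).le
  have hd' : (1 : ℝ) ≤ d := by exact_mod_cast hq1.trans hqd
  have hδd' : (δ : ℝ) ≤ d := by exact_mod_cast hδd
  have hq' : (1 : ℝ) ≤ q := by exact_mod_cast hq1
  -- With light weights at most `c = 11d²η`, this makes `2(δ + d)c ≤ 44d³η = 1`, as the comparison
  -- of forms requires.
  set η : ℝ := 1 / (44 * (d : ℝ) ^ 3) with hη
  have hη0 : 0 < η := by positivity
  have hηd : η * (44 * (d : ℝ) ^ 3) = 1 := by rw [hη]; field_simp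
  set C := ⌈16 * (d : ℝ) ^ 2 / η⌉₊ with hC
  have hsqrt : Filter.Tendsto (fun n : ℕ => η ^ 2 * √(n : ℝ)) Filter.atTop Filter.atTop :=
    (Real.tendsto_sqrt_atTop.comp tendsto_natCast_atTop_atTop).const_mul_atTop (by positivity)
  have hlin : Filter.Tendsto (fun n : ℕ => η * (n : ℝ)) Filter.atTop Filter.atTop :=
    tendsto_natCast_atTop_atTop.const_mul_atTop hη0
  filter_upwards [eventually_sqrt_le_matrixRho_matrixJ hq1 hδ2,
    hsqrt.eventually_ge_atTop (64 * (d : ℝ) ^ 3), hlin.eventually_ge_atTop ((2 : ℝ) ^ C * C),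
    Filter.eventually_ge_atTop (q + 2)] with n hn1 hn2 hn3 hn4 G hG
  rcases lt_or_ge (graphRho G) (√((q : ℝ) * n)) with hlt | hρ
  · exact hlt.le.trans hn1
  have hn4' : (q : ℝ) + 2 ≤ n := by exact_mod_cast hn4
  have : Nonempty (Fin n) := ⟨⟨0, by omega⟩⟩
  obtain ⟨x, hx0, hx1, ⟨z, hz⟩, heig⟩ := exists_perron_vector G
  have hdeg : ∀ S : Finset (Fin n), S.Nonempty → ∃ v ∈ S, (S.filter (G.Adj v)).card ≤ d :=
    fun S hS => hF.exists_card_filter_le_of_free hG hS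
  have hforb : ∀ (L R : Finset (Fin n)) (v : Fin n), L.card = q →
      (∀ u ∈ L, ∀ w ∈ R, G.Adj u w) → v ∉ L → d ≤ R.card →
      (R.filter (G.Adj v)).card < δ := fun L R v hL hLR hv hR => by
    by_contra! h
    exact hG (isContained_of_card_le_card_filter hAB hcover hq hq1 ha₀ hδ hL hLR hv h hR)
  have hheavy := card_heavy_mul_le hdeg (hq1.trans hqd) hη0 hx1 heig
    (by
      rw [Fintype.card_fin]
      exact (Real.sqrt_le_sqrt (by nlinarith)).trans hρ)
    (by rw [Fintype.card_fin]; exact hn2)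
  have hCle : (Finset.univ.filter fun w => η < x w).card ≤ C := by
    have h1 : ((Finset.univ.filter fun w => η < x w).card : ℝ) ≤ 16 * (d : ℝ) ^ 2 / η :=
      (le_div_iff₀ hη0).2 hheavy
    exact Nat.cast_le.1 (h1.trans (Nat.le_ceil _))
  obtain ⟨L, hLc, hxL, hxR, hLd⟩ := exists_dominating_set hdeg hforb hδd hq1 hqd hη0 hηd hx0 hx1 hz
    heig (by rw [Fintype.card_fin]; exact hρ) hCle (by rw [Fintype.card_fin]; exact hn3)
  set lam := matrixRho (matrixJ n q δ) with hlam
  set s := √(((q : ℝ) - δ) ^ 2 / 4 + q * (n - q)) with hs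
  have hlams : lam = ((q : ℝ) + δ - 2) / 2 + s := matrixRho_matrixJ n q δ (by omega)
  have hpos : 0 < (q : ℝ) * (n - q) := mul_pos (by linarith) (by linarith)
  have hss : s * s = ((q : ℝ) - δ) ^ 2 / 4 + q * (n - q) :=
    Real.mul_self_sqrt (by positivity)
  have hsδ : ((δ : ℝ) - q) / 2 < s := Real.lt_sqrt_of_sq_lt (by linarith)
  have hquad := sum_sum_adj_le_of_dominating (lam := lam) hdeg hLc hq1 hx0 hxL hxR (by positivity)
    (by
      calc 2 * ((δ : ℝ) + d) * (11 * d ^ 2 * η) ≤ 2 * ((d : ℝ) + d) * (11 * d ^ 2 * η) := by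
            gcongr
        _ = η * (44 * (d : ℝ) ^ 3) := by ring
        _ ≤ 1 := hηd.le)
    (fun v hv => hforb L _ v hLc (fun u hu w hw => by
      simp only [Finset.mem_filter] at hw
      exact hw.2 u hu) hv hLd)
    (by
      rw [Fintype.card_fin, hlams]
      linear_combination hss)
    (by linarith)
  have hform : ∑ u, ∑ w, (if G.Adj u w then x u * x w else 0) = graphRho G * ∑ u, x u ^ 2 := by
    rw [Finset.mul_sum]
    refine Finset.sum_congr rfl fun u _ => ?_
    rw [← Finset.sum_filter, ← Finset.mul_sum, ← G.neighborFinset_eq_filter, ← heig u]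
    ring
  rw [hform] at hquad
  refine le_of_mul_le_mul_right hquad ?_
  exact Finset.sum_pos' (fun u _ => sq_nonneg _) ⟨z, Finset.mem_univ z, by rw [hz]; norm_num⟩

theorem theorem1p4 {V : Type*} [Fintype V] (F : SimpleGraph V) [DecidableRel F.Adj]
    (hF : F.IsTree) (hcard : 4 ≤ Fintype.card V)
    (A B : Finset V) (hAB : F.IsBipartiteWith (A : Set V) (B : Set V))
    (hcover : ∀ v, v ∈ A ∨ v ∈ B) (hle : A.card ≤ B.card)
    (q δ : ℕ) (hq : A.card = q + 1) (hδ : IsLeast ((fun x => F.degree x) '' (A : Set V)) δ)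
    (hq1 : 1 ≤ q) (hδ2 : 2 ≤ δ) :
    (∀ n : ℕ, q + 2 ≤ n → F.Free (splitGraph n q 1)) ∧
    (∀ᶠ n : ℕ in Filter.atTop,
      ((q : ℝ) - 1) / 2 + √((q : ℝ) * n - (3 * (q : ℝ) ^ 2 + 2 * q + 1) / 4) < spex n F ∧
      spex n F ≤ matrixRho (matrixJ n q δ)) ∧
    (fun n : ℕ => matrixRho (matrixJ n q δ) - (√((q : ℝ) * n) + ((q : ℝ) + δ - 2) / 2))
      =O[Filter.atTop] (fun n : ℕ => 1 / √(n : ℝ)) := by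

  have hdeg : ∀ a ∈ A, 2 ≤ F.degree a := fun a ha => hδ2.trans (hδ.2 ⟨a, ha, rfl⟩)
  have hfree : ∀ n : ℕ, F.Free (splitGraph n q 1) := free_splitGraph_one hF hAB hq hdeg
  obtain ⟨a₀, ha₀, hδ₀⟩ := hδ.1
  refine ⟨fun n _ => hfree n, ?_, matrixRho_matrixJ_isBigO δ hq1⟩
  filter_upwards [Filter.eventually_ge_atTop (q + 2),
    eventually_graphRho_le_matrixRho_matrixJ hF hAB hcover hq ha₀ hδ₀ hq1 hδ2] with n hn hupper
  constructor
  · exact (lt_graphRho_splitGraph_one hq1 hn).trans_le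
      (le_csSup (bddAbove_spex n F) ⟨_, hfree n, rfl⟩)
  · refine csSup_le ⟨_, _, hfree n, rfl⟩ ?_
    rintro r ⟨G, hG, rfl⟩
    exact hupper G hG
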